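/- Let $\mathbb F\in\{\mathbb R,\mathbb C\}$, let $X$ be a locally compact Hausdorff space, and let $C_0(X)=C_0(X,\mathbb F)$ be the Banach algebra of continuous $\mathbb F$-valued functions on $X$ vanishing at infinity, with the supremum norm. A \emph{representation} of a Banach algebra $A$ in a Banach algebra $B$ is a contractive algebra homomorphism $\pi:A\to B$; if $B=B(E)$ is the algebra of bounded operators on a Banach space $E$, then $\pi$ is \emph{non-degenerate} if $\overline{\operatorname{span}}\,\pi(A)E=E$. A measure $\mu$ on a measurable space $(\Omega,\Sigma)$ is \emph{localizable} if it is semi-finite and the Boolean algebra of measurable sets modulo $\mu$-null sets is Dedekind complete. Let $\pi:C_0(X)\to B(E)$ be a non-degenerate representation, where either $E=L^p(\mu)=L^p(\mu,\mathbb F)$ for a localizable measure $\mu$ and $p\in[1,\infty]\setminus\{2\}$, or $E=C_0(\Omega)=C_0(\Omega,\mathbb F)$ for a locally compact Hausdorff space $\Omega$. Call $\pi$ \emph{positive} if for every $a\in C_0(X)$ with $a\ge 0$ the operator $\pi(a)$ maps non-negative functions in $E$ to non-negative functions. (1) If $\mathbb F=\mathbb C$, then $\pi$ is positive. (2) If $\pi$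 is positive (with $\mathbb F=\mathbb R$ or $\mathbb F=\mathbb C$), then $\pi$ is given by multiplication operators: there is a representation $\pi_0:C_0(X)\to L^\infty(\mu)$ if $E=L^p(\mu)$, or $\pi_0:C_0(X)\to C_b(\Omega)$ (the bounded continuous functions) if $E=C_0(\Omega)$, such that \[ [\pi(a)\xi](x)=\pi_0(a)(x)\,\xi(x),\qquad a\in C_0(X),\ \xi\in E, \] for $\mu$-almost every $x$ if $E=L^p(\mu)$, and for every $x\in\Omega$ if $E=C_0(\Omega)$. -/

import Mathlib

open MeasureTheory
open scoped ENNReal ZeroAtInfty BoundedContinuousFunction ComplexOrder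

/-- A measure is localizable if it is semi-finite and the Boolean algebra of measurable sets modulo
null sets is Dedekind complete. The second condition is spelled out on representatives: every
family of measurable sets has a supremum for inclusion up to null sets. -/
structure IsLocalizable {Ω : Type*} [MeasurableSpace Ω] (μ : Measure Ω) : Prop where
  semifinite : ∀ s : Set Ω, MeasurableSet s → μ s = ∞ →
    ∃ t : Set Ω, t ⊆ s ∧ MeasurableSet t ∧ 0 < μ t ∧ μ t < ∞
  exists_essSup : ∀ 𝒜 : Set (Set Ω), (∀ A ∈ 𝒜, MeasurableSet A) →
    ∃ S : Set Ω, MeasurableSet S ∧ (∀ A ∈ 𝒜, μ (A \ S) = 0) ∧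
      ∀ T : Set Ω, MeasurableSet T → (∀ A ∈ 𝒜, μ (A \ T) = 0) → μ (S \ T) = 0

/-- A map between normed spaces is contractive if it does not increase norms. A representation of a
Banach algebra is a contractive algebra homomorphism. -/
def IsContractive {A B : Type*} [Norm A] [Norm B] (π : A → B) : Prop :=
  ∀ a : A, ‖π a‖ ≤ ‖a‖

/-- Non-degeneracy of a family of operators `π : A → B(E)`: the closed linear span of `π(A)E`
is `E`. -/
def IsNondegenerate {𝕜 A E : Type*} [RCLike 𝕜] [NormedAddCommGroup E] [NormedSpace 𝕜 E]
    (π : A → (E →L[𝕜] E)) : Prop :=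
  (Submodule.span 𝕜 {η : E | ∃ (a : A) (ξ : E), η = π a ξ}).topologicalClosure = ⊤

/-- An operator on `L^p(μ)` is positive if it preserves (a.e.) non-negative functions. In the
complex case, `0 ≤ z` means that `z` is real and non-negative. -/
def IsPositiveOnLp {𝕜 Ω : Type*} [RCLike 𝕜] [MeasurableSpace Ω] {μ : Measure Ω} {p : ℝ≥0∞}
    [Fact (1 ≤ p)] (T : Lp 𝕜 p μ →L[𝕜] Lp 𝕜 p μ) : Prop :=
  ∀ ξ : Lp 𝕜 p μ, (∀ᵐ x ∂μ, 0 ≤ ξ x) → ∀ᵐ x ∂μ, 0 ≤ (T ξ) x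

/-- An operator on `C_0(Ω)` is positive if it preserves non-negative functions. -/
def IsPositiveOnC0 {𝕜 Ω : Type*} [RCLike 𝕜] [TopologicalSpace Ω]
    (T : C₀(Ω, 𝕜) →L[𝕜] C₀(Ω, 𝕜)) : Prop :=
  ∀ ξ : C₀(Ω, 𝕜), (∀ x, 0 ≤ ξ x) → ∀ x, 0 ≤ (T ξ) x

/-! An approximate unit and non-degeneracy extend the contractive `π` to the functions `a + c`. For
complex scalars and real-valued `a`, the estimate `‖1 + i t a‖ ≤ 1 + O(t²)` makes `π a` Hermitian.
On `L^p` with `p ≠ 2`, and on `C₀`, a Hermitian operator `T` is local: `T ξ` vanishes where `ξ`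
does. For finite `p` one compares the pairing of `T (u + c v)` with the dual element of `u + c v`,
for `u` and `v` of disjoint supports: on the support of `v` that element scales like
`conj c * |c| ^ (p - 2)`, which is real-homogeneous of degree one in `c` only if `p = 2`. On `L^∞`
and `C₀` one applies `T` to functions in the unit ball that equal `1` where `ξ` vanishes. Norm
bounds on a local operator hold pointwise, so `‖π a - ‖a‖ / 2‖ ≤ ‖a‖ / 2` and the Hermitian
estimate make `π a` positive for `a ≥ 0`.

If `π` is positive, then `0 ≤ π a ξ ≤ ‖a‖ ξ` for `a ≥ 0` and `ξ ≥ 0`, so every `π a` is local. A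
local operator is a multiplication; its multiplier is read off near each point for `C₀`, and for
`L^p` on sets of finite measure, where localizability glues the pieces. -/

open Filter Topology ComplexConjugate

section ZeroAtInfty

variable {X : Type*} [TopologicalSpace X]

lemma zeroAtInfty_norm_apply_le {β : Type*} [SeminormedAddCommGroup β] (f : C₀(X, β)) (x : X) :
    ‖f x‖ ≤ ‖f‖ :=
  f.toBCF.norm_coe_le_norm x

lemma zeroAtInfty_norm_le {β : Type*} [SeminormedAddCommGroup β] {f : C₀(X, β)} {r : ℝ}
    (hr : 0 ≤ r) : ‖f‖ ≤ r ↔ ∀ x, ‖f x‖ ≤ r :=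
  BoundedContinuousFunction.norm_le (f := f.toBCF) hr

/-- Postcomposition of a function vanishing at infinity with a continuous map fixing `0`. -/
def zeroAtInftyPostcomp {β γ : Type*} [TopologicalSpace β] [Zero β] [TopologicalSpace γ] [Zero γ]
    (φ : C(β, γ)) (hφ : φ 0 = 0) (f : C₀(X, β)) : C₀(X, γ) where
  toFun x := φ (f x)
  zero_at_infty' := by
    rw [← hφ]; exact (φ.continuous.tendsto 0).comp f.zero_at_infty'

@[simp]
lemma zeroAtInftyPostcomp_apply {β γ : Type*} [TopologicalSpace β] [Zero β] [TopologicalSpace γ]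
    [Zero γ] (φ : C(β, γ)) (hφ : φ 0 = 0) (f : C₀(X, β)) (x : X) :
    zeroAtInftyPostcomp φ hφ f x = φ (f x) :=
  rfl

variable {𝕜 : Type*} [RCLike 𝕜]

lemma exists_zeroAtInfty_norm_mul_sub_le (s : Finset C₀(X, 𝕜)) {ε : ℝ} (hε : 0 < ε) :
    ∃ e : C₀(X, 𝕜), (∀ x, 0 ≤ e x) ∧ ‖e‖ ≤ 1 ∧ ∀ b ∈ s, ‖e * b - b‖ ≤ ε := by
  let h (x : X) : ℝ := ∑ b ∈ s, ‖b x‖ ^ 2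
  have h_cont : Continuous h := by fun_prop
  have h_nonneg (x : X) : 0 ≤ h x := by positivity
  have h_pos (x : X) : 0 < h x + ε ^ 2 := by have := h_nonneg x; positivity
  have h_lim : Tendsto h (cocompact X) (𝓝 0) := by
    simpa using tendsto_finsetSum s fun b _ => b.zero_at_infty'.norm.pow 2
  have h_frac_lim : Tendsto (fun x => h x / (h x + ε ^ 2)) (cocompact X) (𝓝 0) := by
    rw [← zero_div (0 + ε ^ 2)]
    exact h_lim.div (h_lim.add_const (ε ^ 2)) (by positivity)
  let e : C₀(X, 𝕜) :=
    { toFun := fun x => ((h x / (h x + ε ^ 2) : ℝ) : 𝕜)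
      continuous_toFun := RCLike.continuous_ofReal.comp
        (h_cont.div₀ (h_cont.add_const _) fun x => (h_pos x).ne')
      zero_at_infty' := by
        rw [← RCLike.ofReal_zero]
        exact (RCLike.continuous_ofReal.tendsto 0).comp h_frac_lim }
  have he_apply (x : X) : e x = ((h x / (h x + ε ^ 2) : ℝ) : 𝕜) := rfl
  refine ⟨e, fun x => RCLike.ofReal_nonneg.2 (div_nonneg (h_nonneg x) (h_pos x).le),
    (zeroAtInfty_norm_le zero_le_one).2 fun x => ?_, fun b hb =>
    (zeroAtInfty_norm_le hε.le).2 fun x => ?_⟩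
  · rw [he_apply, RCLike.norm_ofReal, abs_of_nonneg (div_nonneg (h_nonneg x) (h_pos x).le),
      div_le_one (h_pos x)]
    exact le_add_of_nonneg_right (sq_nonneg ε)
  · have hbh : ‖b x‖ ^ 2 ≤ h x :=
      Finset.single_le_sum (f := fun b : C₀(X, 𝕜) => ‖b x‖ ^ 2) (fun _ _ => sq_nonneg _) hb
    have h_sub : (e * b - b) x = ((-(ε ^ 2 / (h x + ε ^ 2)) : ℝ) : 𝕜) * b x := by
      have : h x / (h x + ε ^ 2) - 1 = -(ε ^ 2 / (h x + ε ^ 2)) := by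
        field_simp [(h_pos x).ne']; ring
      rw [← this]
      simp only [ZeroAtInftyContinuousMap.sub_apply, ZeroAtInftyContinuousMap.mul_apply, he_apply,
        RCLike.ofReal_sub, RCLike.ofReal_one]
      ring
    rw [h_sub, norm_mul, RCLike.norm_ofReal, abs_neg,
      abs_of_nonneg (div_nonneg (sq_nonneg ε) (h_pos x).le), div_mul_eq_mul_div,
      div_le_iff₀ (h_pos x)]
    nlinarith [sq_nonneg (‖b x‖ - ε), norm_nonneg (b x)]

variable (X 𝕜) in
lemma exists_isApproximateUnit_zeroAtInfty :
    ∃ l : Filter C₀(X, 𝕜), l.IsApproximateUnit ∧ ∀ᶠ e in l, (∀ x, 0 ≤ e x) ∧ ‖e‖ ≤ 1 := by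
  classical
  choose e he_nonneg he_norm he_mul using fun i : Finset C₀(X, 𝕜) × ℕ =>
    exists_zeroAtInfty_norm_mul_sub_le i.1 (Nat.one_div_pos_of_nat (n := i.2) (α := ℝ))
  have h_lim (b : C₀(X, 𝕜)) : Tendsto (· * b) (map e atTop) (𝓝 b) := by
    rw [tendsto_map'_iff, Function.comp_def, tendsto_iff_norm_sub_tendsto_zero]
    have h_snd : Tendsto (Prod.snd : Finset C₀(X, 𝕜) × ℕ → ℕ) atTop atTop := by
      rw [← prod_atTop_atTop_eq]; exact tendsto_snd
    refine squeeze_zero' (Eventually.of_forall fun _ => norm_nonneg _) ?_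
      ((tendsto_one_div_add_atTop_nhds_zero_nat (𝕜 := ℝ)).comp h_snd)
    filter_upwards [eventually_ge_atTop ({b}, 0)] with i hi
    exact he_mul i b (Finset.singleton_subset_iff.1 hi.1)
  refine ⟨map e atTop, ⟨fun b => ?_, h_lim⟩,
    eventually_map.2 (Eventually.of_forall fun i => ⟨he_nonneg i, he_norm i⟩)⟩
  simpa only [mul_comm b] using h_lim b

variable (𝕜) in
lemma exists_zeroAtInfty_apply_ne_zero [RegularSpace X] [LocallyCompactSpace X] (x : X) :
    ∃ f : C₀(X, 𝕜), f x ≠ 0 := by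
  obtain ⟨f, hf_one, -, hf_supp, -⟩ := exists_continuous_one_zero_of_isCompact
    (isCompact_singleton (x := x)) isClosed_empty (Set.disjoint_empty _)
  have hf_lim : Tendsto (fun y => (f y : 𝕜)) (cocompact X) (𝓝 0) :=
    (hf_supp.comp_left (g := ((↑) : ℝ → 𝕜)) RCLike.ofReal_zero).is_zero_at_infty
  refine ⟨⟨⟨fun y => (f y : 𝕜), by fun_prop⟩, hf_lim⟩, ?_⟩
  change (f x : 𝕜) ≠ 0
  simp [hf_one rfl]

lemma exists_zeroAtInfty_apply_eq_one {f : C₀(X, 𝕜)} {x : X} (hx : f x ≠ 0) :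
    ∃ g : C₀(X, 𝕜), g x = 1 ∧ ‖g‖ ≤ 1 := by
  have hx' : 0 < ‖f x‖ := norm_pos_iff.2 hx
  let φ : C(𝕜, 𝕜) := ⟨fun z => ((min (‖z‖ / ‖f x‖) 1 : ℝ) : 𝕜), by fun_prop⟩
  have hφ (z : 𝕜) : φ z = ((min (‖z‖ / ‖f x‖) 1 : ℝ) : 𝕜) := rfl
  refine ⟨zeroAtInftyPostcomp φ (by simp [hφ]) f, ?_,
    (zeroAtInfty_norm_le zero_le_one).2 fun y => ?_⟩
  · rw [zeroAtInftyPostcomp_apply, hφ, div_self hx'.ne', min_self, RCLike.ofReal_one]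
  · rw [zeroAtInftyPostcomp_apply, hφ, RCLike.norm_ofReal, abs_of_nonneg (by positivity)]
    exact min_le_right _ _

end ZeroAtInfty

section NonnegativeParts

variable {𝕜 : Type*} [RCLike 𝕜]

variable (𝕜) in
lemma exists_nonneg_decomposition :
    ∃ (c : Fin 4 → 𝕜) (φ : Fin 4 → C(𝕜, 𝕜)), (∀ i z, 0 ≤ φ i z) ∧ (∀ i z, ‖φ i z‖ ≤ ‖z‖) ∧
      ∀ z, z = ∑ i, c i * φ i z := by
  let u : Fin 4 → 𝕜 → ℝ :=
    ![RCLike.re, fun z => -RCLike.re z, RCLike.im, fun z => -RCLike.im z]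
  have hu_cont (i : Fin 4) : Continuous (u i) := by
    fin_cases i
    exacts [RCLike.continuous_re, RCLike.continuous_re.neg, RCLike.continuous_im,
      RCLike.continuous_im.neg]
  have hu_le (i : Fin 4) (z : 𝕜) : u i z ≤ ‖z‖ := by
    fin_cases i
    exacts [RCLike.re_le_norm z, (neg_le_abs _).trans (RCLike.abs_re_le_norm z),
      RCLike.im_le_norm z, (neg_le_abs _).trans (RCLike.abs_im_le_norm z)]
  refine ⟨![1, -1, RCLike.I, -RCLike.I],
    fun i => ⟨fun z => ((max (u i z) 0 : ℝ) : 𝕜), by have := hu_cont i; fun_prop⟩,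
    fun i z => RCLike.ofReal_nonneg.2 (le_max_right _ _), fun i z => ?_, fun z => ?_⟩
  · rw [ContinuousMap.coe_mk, RCLike.norm_ofReal, abs_of_nonneg (le_max_right (u i z) 0)]
    exact max_le (hu_le i z) (norm_nonneg z)
  · have h_parts (t : ℝ) : (t : 𝕜) = (max t 0 : ℝ) - (max (-t) 0 : ℝ) := by
      rw [← RCLike.ofReal_sub, max_zero_sub_max_neg_zero_eq_self]
    trans ((max (RCLike.re z) 0 : ℝ) - (max (-RCLike.re z) 0 : ℝ) : 𝕜)
      + ((max (RCLike.im z) 0 : ℝ) - (max (-RCLike.im z) 0 : ℝ) : 𝕜) * RCLike.I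
    · rw [← h_parts, ← h_parts, RCLike.re_add_im]
    · simp [Fin.sum_univ_four, u]
      ring

end NonnegativeParts

section Representation

lemma IsContractive.continuous {A B F : Type*} [SeminormedAddCommGroup A]
    [SeminormedAddCommGroup B] [FunLike F A B] [AddMonoidHomClass F A B] {π : F}
    (hπ : IsContractive π) : Continuous π :=
  AddMonoidHomClass.continuous_of_bound π 1 fun a => by simpa only [one_mul] using hπ a

variable {𝕜 E : Type*} [RCLike 𝕜] [NormedAddCommGroup E] [NormedSpace 𝕜 E]

lemma IsContractive.norm_apply_le {A : Type*} [Norm A] {π : A → (E →L[𝕜] E)}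
    (hπ : IsContractive π) (a : A) (ξ : E) : ‖π a ξ‖ ≤ ‖a‖ * ‖ξ‖ :=
  (π a).le_of_opNorm_le (hπ a) ξ

lemma IsNondegenerate.tendsto_apply {A : Type*} [NonUnitalSeminormedRing A] [Module 𝕜 A]
    {π : A →ₙₐ[𝕜] (E →L[𝕜] E)} (hnd : IsNondegenerate π) (hπ : IsContractive π)
    {l : Filter A} (hl : l.IsApproximateUnit) (hl_norm : ∀ᶠ e in l, ‖e‖ ≤ 1) (ξ : E) :
    Tendsto (fun e => π e ξ) l (𝓝 ξ) := by
  have h_span : ∀ ζ ∈ Submodule.span 𝕜 {η : E | ∃ (a : A) (ξ : E), η = π a ξ},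
      Tendsto (fun e => π e ζ) l (𝓝 ζ) := by
    intro ζ hζ
    induction hζ using Submodule.span_induction with
    | mem x hx =>
      obtain ⟨a, η, rfl⟩ := hx
      have h : Tendsto (fun e => π (e * a) η) l (𝓝 (π a η)) :=
        (((ContinuousLinearMap.apply 𝕜 E η).continuous.comp hπ.continuous).tendsto a).comp
          (hl.tendsto_mul_right a)
      simpa only [map_mul, mul_apply_eq_comp] using h
    | zero => simpa only [map_zero] using tendsto_const_nhds
    | add x y _ _ hx hy => simpa only [map_add] using hx.add hy
    | smul c x _ hx => simpa only [map_smul] using hx.const_smul c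
  have h_mem : ξ ∈ closure (Submodule.span 𝕜
      {η : E | ∃ (a : A) (ξ : E), η = π a ξ} : Set E) := by
    rw [← Submodule.topologicalClosure_coe, hnd]; trivial
  rw [Metric.tendsto_nhds]
  intro ε hε
  obtain ⟨ζ, hζ, hξζ⟩ := Metric.mem_closure_iff.1 h_mem (ε / 3) (by positivity)
  filter_upwards [hl_norm, (Metric.tendsto_nhds.1 (h_span ζ hζ)) (ε / 3) (by positivity)]
    with e he h_dist
  have h_contr : dist (π e ξ) (π e ζ) ≤ dist ξ ζ := by
    rw [dist_eq_norm, dist_eq_norm, ← map_sub]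
    exact (hπ.norm_apply_le e _).trans (mul_le_of_le_one_left (norm_nonneg _) he)
  calc dist (π e ξ) ξ ≤ dist (π e ξ) (π e ζ) + dist (π e ζ) ζ + dist ζ ξ :=
        dist_triangle4 _ _ _ _
    _ < ε := by rw [dist_comm ζ ξ]; linarith

variable {X : Type*} [TopologicalSpace X] {π : C₀(X, 𝕜) →ₙₐ[𝕜] (E →L[𝕜] E)}

-- Contractivity of the unital extension of `π` to the functions `a + c`.
lemma IsNondegenerate.norm_apply_add_smul_le (hnd : IsNondegenerate π) (hπ : IsContractive π)
    {a : C₀(X, 𝕜)} {c : 𝕜} {r : ℝ} (hr : 0 ≤ r) (ha : ∀ x, ‖a x + c‖ ≤ r) (ξ : E) :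
    ‖π a ξ + c • ξ‖ ≤ r * ‖ξ‖ := by
  obtain ⟨l, hl, hl_unit⟩ := exists_isApproximateUnit_zeroAtInfty X 𝕜
  have := hl.neBot
  have h_strong := hnd.tendsto_apply hπ hl (hl_unit.mono fun _ he => he.2)
  have h_lim : Tendsto (fun e => π (e * a + c • e) ξ) l (𝓝 (π a ξ + c • ξ)) := by
    simpa only [map_add, map_mul, map_smul, add_apply, smul_apply, mul_apply_eq_comp] using
      (h_strong (π a ξ)).add ((h_strong ξ).const_smul c)
  refine le_of_tendsto h_lim.norm (hl_unit.mono fun e he => ?_)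
  have h_norm : ‖e * a + c • e‖ ≤ r := (zeroAtInfty_norm_le hr).2 fun x =>
    calc ‖(e * a + c • e) x‖ = ‖e x‖ * ‖a x + c‖ := by
          rw [← norm_mul, mul_add, mul_comm (e x) c]; rfl
      _ ≤ 1 * r := by
          gcongr
          exacts [(zeroAtInfty_norm_apply_le e x).trans he.2, ha x]
      _ = r := one_mul r
  exact (hπ.norm_apply_le _ ξ).trans (by gcongr)

lemma IsNondegenerate.norm_smul_sub_apply_mem (hnd : IsNondegenerate π) (hπ : IsContractive π)
    {P : Set E} (hP : IsClosed P)
    (hPπ : ∀ a : C₀(X, 𝕜), (∀ x, 0 ≤ a x) → ∀ ξ ∈ P, π a ξ ∈ P)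
    {a : C₀(X, 𝕜)} (ha : ∀ x, 0 ≤ a x) {ξ : E} (hξ : ξ ∈ P) :
    (‖a‖ : 𝕜) • ξ - π a ξ ∈ P := by
  obtain ⟨l, hl, hl_unit⟩ := exists_isApproximateUnit_zeroAtInfty X 𝕜
  have := hl.neBot
  have h_strong := hnd.tendsto_apply hπ hl (hl_unit.mono fun _ he => he.2)
  have h_lim : Tendsto (fun e => π ((‖a‖ : 𝕜) • e - e * a) ξ) l
      (𝓝 ((‖a‖ : 𝕜) • ξ - π a ξ)) := by
    simpa only [map_sub, map_mul, map_smul, sub_apply, smul_apply, mul_apply_eq_comp] using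
      ((h_strong ξ).const_smul (‖a‖ : 𝕜)).sub (h_strong (π a ξ))
  refine hP.mem_of_tendsto h_lim (hl_unit.mono fun e he => hPπ _ (fun x => ?_) ξ hξ)
  have h_le : a x ≤ ‖a‖ := by
    obtain ⟨t, ht, hat⟩ := RCLike.nonneg_iff_exists_ofReal.1 (ha x)
    rw [← hat, RCLike.ofReal_le_ofReal]
    calc t = ‖a x‖ := by rw [← hat, RCLike.norm_ofReal, abs_of_nonneg ht]
      _ ≤ ‖a‖ := zeroAtInfty_norm_apply_le a x
  have h_eq : ((‖a‖ : 𝕜) • e - e * a) x = e x * (‖a‖ - a x) := by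
    simp only [ZeroAtInftyContinuousMap.sub_apply, ZeroAtInftyContinuousMap.smul_apply,
      ZeroAtInftyContinuousMap.mul_apply, smul_eq_mul]
    ring
  rw [h_eq]
  exact mul_nonneg (he.1 x) (sub_nonneg.2 h_le)

end Representation

section Hermitian

/-- `T` is Hermitian, i.e. has real numerical range, if `‖1 + itT‖ ≤ 1 + o(t)` for real `t → 0`;
operators coming from representations satisfy this with the error `O(t²)` demanded here. -/
def IsHermitianOp {E : Type*} [NormedAddCommGroup E] [NormedSpace ℂ E] (T : E →L[ℂ] E) : Prop :=
  ∃ C : NNReal, ∀ (t : ℝ) (ξ : E), ‖ξ + ((t : ℂ) * Complex.I) • T ξ‖ ≤ (1 + t ^ 2 * C) * ‖ξ‖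

lemma eq_zero_of_forall_mul_le_sq_mul {a D : ℝ} (h : ∀ t : ℚ, t * a ≤ (t : ℝ) ^ 2 * D) : a = 0 := by
  have h_lim : Tendsto (fun n : ℕ => 1 / ((n : ℝ) + 1) * D) atTop (𝓝 0) := by
    simpa only [zero_mul] using tendsto_one_div_add_atTop_nhds_zero_nat.mul_const D
  have h_le (n : ℕ) (s : ℚ) (hs : s ^ 2 = 1) : s * a ≤ 1 / ((n : ℝ) + 1) * D := by
    have h_pos : 0 < 1 / ((n : ℝ) + 1) := Nat.one_div_pos_of_nat
    have hs' : (s : ℝ) ^ 2 = 1 := mod_cast hs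
    have := h (s * (1 / (n + 1)))
    push_cast at this
    rw [mul_pow, hs'] at this
    refine le_of_mul_le_mul_left ?_ h_pos
    linarith
  refine le_antisymm (ge_of_tendsto' h_lim fun n => ?_)
    (neg_nonpos.1 (ge_of_tendsto' h_lim fun n => ?_))
  · simpa using h_le n 1 (by norm_num)
  · simpa using h_le n (-1) (by norm_num)

lemma im_eq_zero_of_forall_norm_add_le {z : ℂ} {w C : ℝ}
    (h : ∀ t : ℚ, ‖w + ((t : ℝ) : ℂ) * Complex.I * z‖ ≤ (1 + (t : ℝ) ^ 2 * C) * w) :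
    z.im = 0 := by
  refine neg_eq_zero.1 (eq_zero_of_forall_mul_le_sq_mul (D := C * w) fun t => ?_)
  have h_re : (w + ((t : ℝ) : ℂ) * Complex.I * z).re = w + t * -z.im := by
    simp [mul_assoc]
  have := (Complex.re_le_norm _).trans (h t)
  rw [h_re] at this
  linarith

lemma nonneg_of_norm_sub_le_of_forall_norm_add_le {z w : ℂ} (hw : 0 ≤ w) {r C : ℝ}
    (h_sub : ‖z - r * w‖ ≤ r * ‖w‖)
    (h_add : ∀ t : ℚ, ‖w + ((t : ℝ) : ℂ) * Complex.I * z‖ ≤ (1 + (t : ℝ) ^ 2 * C) * ‖w‖) :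
    0 ≤ z := by
  obtain ⟨s, hs, rfl⟩ := RCLike.nonneg_iff_exists_ofReal.1 hw
  simp only [Complex.coe_algebraMap, Complex.norm_of_nonneg hs] at h_sub h_add
  refine Complex.nonneg_iff.2 ⟨?_, (im_eq_zero_of_forall_norm_add_le h_add).symm⟩
  have h_re := (Complex.abs_re_le_norm _).trans h_sub
  rw [Complex.sub_re, Complex.re_ofReal_mul, Complex.ofReal_re] at h_re
  linarith [neg_le_of_abs_le h_re]

lemma eq_zero_of_im_add_mul_eq_zero {u v : ℂ} {r : ℝ} (hr : r ≠ 0) (h_pos : (u + r * v).im = 0)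
    (h_neg : (u + -r * v).im = 0) (h_I : (u + r * Complex.I * v).im = 0) : v = 0 := by
  simp only [mul_assoc, neg_mul, Complex.add_im, Complex.neg_im, Complex.im_ofReal_mul,
    Complex.I_mul_im] at h_pos h_neg h_I
  have hv_im : r * v.im = 0 := by linarith
  have hv_re : r * v.re = 0 := by linarith
  exact Complex.ext ((mul_eq_zero.1 hv_re).resolve_left hr) ((mul_eq_zero.1 hv_im).resolve_left hr)

section Representation

variable {X E : Type*} [TopologicalSpace X] [NormedAddCommGroup E] [NormedSpace ℂ E]
  {π : C₀(X, ℂ) →ₙₐ[ℂ] (E →L[ℂ] E)}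

lemma IsNondegenerate.isHermitianOp (hnd : IsNondegenerate π) (hπ : IsContractive π)
    {a : C₀(X, ℂ)} (ha : ∀ x, (a x).im = 0) : IsHermitianOp (π a) := by
  refine ⟨⟨‖a‖ ^ 2, by positivity⟩, fun t ξ => ?_⟩
  have h_norm (x : X) : ‖((t : ℂ) * Complex.I * a x) + 1‖ ≤ 1 + t ^ 2 * ‖a‖ ^ 2 := by
    have h_re : (a x).re ^ 2 ≤ ‖a‖ ^ 2 := sq_le_sq' (abs_le.1 ((Complex.abs_re_le_norm _).trans
      (zeroAtInfty_norm_apply_le a x))).1 ((Complex.re_le_norm _).trans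
      (zeroAtInfty_norm_apply_le a x))
    have h_nonneg : 0 ≤ t ^ 2 * ‖a‖ ^ 2 := by positivity
    refine le_of_sq_le_sq ?_ (by positivity)
    rw [← Complex.normSq_eq_norm_sq, Complex.normSq_apply]
    simp only [Complex.add_re, Complex.add_im, Complex.one_re, Complex.one_im, mul_assoc,
      Complex.re_ofReal_mul, Complex.im_ofReal_mul, Complex.I_mul_re, Complex.I_mul_im, ha x]
    nlinarith [mul_le_mul_of_nonneg_left h_re (sq_nonneg t)]
  have := hnd.norm_apply_add_smul_le hπ (a := ((t : ℂ) * Complex.I) • a) (c := 1) (by positivity)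
    h_norm ξ
  rwa [map_smul, one_smul, add_comm] at this

lemma IsNondegenerate.norm_apply_add_neg_smul_le (hnd : IsNondegenerate π) (hπ : IsContractive π)
    {a : C₀(X, ℂ)} (ha : ∀ x, 0 ≤ a x) (ξ : E) :
    ‖π a ξ + -((‖a‖ / 2 : ℝ) : ℂ) • ξ‖ ≤ ‖a‖ / 2 * ‖ξ‖ := by
  refine hnd.norm_apply_add_smul_le hπ (by positivity) (fun x => ?_) ξ
  obtain ⟨s, hs, hsa⟩ : ∃ s : ℝ, 0 ≤ s ∧ (s : ℂ) = a x :=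
    RCLike.nonneg_iff_exists_ofReal.1 (ha x)
  have hs_le : s ≤ ‖a‖ := by
    simpa [← hsa, abs_of_nonneg hs] using zeroAtInfty_norm_apply_le a x
  rw [← hsa, ← Complex.ofReal_neg, ← Complex.ofReal_add, Complex.norm_real,
    Real.norm_eq_abs, abs_le]
  constructor <;> linarith

end Representation

end Hermitian

section LpPairing

/-- The duality map of `L^q` on scalars, `conj z * |z| ^ (q - 2)`, with value `0` at `0` also for
`q < 2`. -/
noncomputable def lpDual (q : ℝ) (z : ℂ) : ℂ := conj z * ((‖z‖ ^ (q - 2) : ℝ) : ℂ)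

@[simp]
lemma lpDual_zero (q : ℝ) : lpDual q 0 = 0 := by simp [lpDual]

lemma lpDual_mul (q : ℝ) (z w : ℂ) : lpDual q (z * w) = lpDual q z * lpDual q w := by
  simp only [lpDual, map_mul, norm_mul, Real.mul_rpow (norm_nonneg z) (norm_nonneg w),
    Complex.ofReal_mul]
  ring

@[fun_prop]
lemma measurable_lpDual (q : ℝ) : Measurable (lpDual q) := by
  unfold lpDual
  fun_prop

lemma mul_lpDual_self {q : ℝ} (hq : q ≠ 0) (z : ℂ) : z * lpDual q z = ((‖z‖ ^ q : ℝ) : ℂ) := by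
  rcases eq_or_ne z 0 with rfl | hz
  · simp [Real.zero_rpow hq]
  · rw [lpDual, ← mul_assoc, Complex.mul_conj, Complex.normSq_eq_norm_sq, ← Complex.ofReal_mul,
      ← Real.rpow_natCast, ← Real.rpow_add (norm_pos_iff.2 hz)]
    congr 2
    push_cast
    ring

lemma norm_lpDual_le (q : ℝ) (z : ℂ) : ‖lpDual q z‖ ≤ ‖z‖ ^ (q - 1) := by
  rcases eq_or_ne z 0 with rfl | hz
  · simpa only [lpDual_zero, norm_zero] using Real.zero_rpow_nonneg _
  · refine le_of_eq ?_
    rw [lpDual, norm_mul, RCLike.norm_conj, Complex.norm_real,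
      Real.norm_of_nonneg (by positivity), mul_comm, ← Real.rpow_add_one (norm_ne_zero_iff.2 hz)]
    congr 1
    ring

lemma norm_mul_lpDual_le {q : ℝ} (hq : 1 ≤ q) (w z : ℂ) :
    ‖w * lpDual q z‖ ≤ q⁻¹ * ‖w‖ ^ q + (1 - q⁻¹) * ‖z‖ ^ q := by
  have hq₀ : q ≠ 0 := by positivity
  calc ‖w * lpDual q z‖ ≤ ‖w‖ * ‖z‖ ^ (q - 1) := by
        rw [norm_mul]
        gcongr
        exact norm_lpDual_le q z
    _ = (‖w‖ ^ q) ^ q⁻¹ * (‖z‖ ^ q) ^ (1 - q⁻¹) := by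
        rw [← Real.rpow_mul (norm_nonneg w), ← Real.rpow_mul (norm_nonneg z), mul_one_sub,
          mul_inv_cancel₀ hq₀, Real.rpow_one]
    _ ≤ q⁻¹ * ‖w‖ ^ q + (1 - q⁻¹) * ‖z‖ ^ q :=
        Real.geom_mean_le_arith_mean2_weighted (by positivity)
          (sub_nonneg.2 (inv_le_one_of_one_le₀ hq)) (by positivity) (by positivity)
          (add_sub_cancel _ _)

lemma two_mul_two_rpow_sub_two_ne {q : ℝ} (hq : q ≠ 2) : (2 : ℝ) * 2 ^ (q - 2) ≠ 2 := by
  intro h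
  have h_one : (2 : ℝ) ^ (q - 2) = 2 ^ (0 : ℝ) := by rw [Real.rpow_zero]; linarith
  have := (Real.strictMono_rpow_of_base_gt_one one_lt_two).injective h_one
  exact hq (by linarith)

lemma eq_zero_of_forall_im_lpDual_mul_add_eq_zero {q : ℝ} (hq : q ≠ 2) {z w : ℂ}
    (h : ∀ c : ℂ, (lpDual q c * z + c * w).im = 0) : w = 0 := by
  have h_im {z w : ℂ} (h : ∀ c : ℂ, (lpDual q c * z + c * w).im = 0) : w.im = 0 := by
    have h_one := h 1
    have h_two := h (2 : ℝ)
    simp only [lpDual, Complex.conj_ofReal, map_one, norm_one, Real.one_rpow, Complex.norm_real,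
      Real.norm_ofNat, ← Complex.ofReal_mul, Complex.ofReal_one, one_mul, Complex.add_im,
      Complex.im_ofReal_mul] at h_one h_two
    have h_mul : ((2 : ℝ) * 2 ^ (q - 2) - 2) * w.im = 0 := by
      linear_combination (2 * 2 ^ (q - 2)) * h_one - h_two
    exact (mul_eq_zero.1 h_mul).resolve_left (sub_ne_zero.2 (two_mul_two_rpow_sub_two_ne hq))
  refine Complex.ext ?_ (h_im h)
  have h_rot := h_im (z := lpDual q Complex.I * z) (w := Complex.I * w) fun c => by
    simpa only [lpDual_mul, mul_assoc] using h (c * Complex.I)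
  simpa only [Complex.I_mul_im, Complex.zero_re] using h_rot

variable {Ω : Type*} [MeasurableSpace Ω] {μ : Measure Ω} {p : ℝ≥0∞}

/-- The Lumer semi-inner product of `L^p`, up to the factor `‖f‖ ^ (2 - p)`. It is linear in `g`
only. -/
noncomputable def lpPairing (g f : Lp ℂ p μ) : ℂ := ∫ x, g x * lpDual p.toReal (f x) ∂μ

lemma integrable_norm_rpow (hp₀ : p ≠ 0) (hp : p ≠ ∞) (f : Lp ℂ p μ) :
    Integrable (fun x => ‖f x‖ ^ p.toReal) μ :=
  (Lp.memLp f).integrable_norm_rpow hp₀ hp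

lemma norm_rpow_eq_integral (hp₀ : p ≠ 0) (hp : p ≠ ∞) (f : Lp ℂ p μ) :
    ‖f‖ ^ p.toReal = ∫ x, ‖f x‖ ^ p.toReal ∂μ := by
  have h_nonneg : 0 ≤ ∫ x, ‖f x‖ ^ p.toReal ∂μ := integral_nonneg fun x => by positivity
  rw [Lp.norm_def, (Lp.memLp f).eLpNorm_eq_integral_rpow_norm hp₀ hp,
    ENNReal.toReal_ofReal (by positivity), ← Real.rpow_mul h_nonneg,
    inv_mul_cancel₀ (ENNReal.toReal_pos hp₀ hp).ne', Real.rpow_one]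

lemma lpPairing_self (hp₀ : p ≠ 0) (hp : p ≠ ∞) (f : Lp ℂ p μ) :
    lpPairing f f = ((‖f‖ ^ p.toReal : ℝ) : ℂ) := by
  simp only [lpPairing, mul_lpDual_self (ENNReal.toReal_pos hp₀ hp).ne', integral_complex_ofReal,
    norm_rpow_eq_integral hp₀ hp]

lemma lpPairing_congr_left {g h f : Lp ℂ p μ} (hgh : ∀ᵐ x ∂μ, f x ≠ 0 → g x = h x) :
    lpPairing g f = lpPairing h f := by
  refine integral_congr_ae (hgh.mono fun x hx => ?_)
  by_cases hf : f x = 0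
  · simp [hf]
  · simp [hx hf]

lemma lpPairing_smul_left (c : ℂ) (g f : Lp ℂ p μ) : lpPairing (c • g) f = c * lpPairing g f := by
  rw [lpPairing, lpPairing, ← integral_const_mul]
  refine integral_congr_ae ?_
  filter_upwards [Lp.coeFn_smul c g] with x hx
  rw [hx, Pi.smul_apply, smul_eq_mul, mul_assoc]

lemma lpPairing_smul_right (c : ℂ) (g f : Lp ℂ p μ) :
    lpPairing g (c • f) = lpDual p.toReal c * lpPairing g f := by
  rw [lpPairing, lpPairing, ← integral_const_mul]
  refine integral_congr_ae ?_
  filter_upwards [Lp.coeFn_smul c f] with x hx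
  rw [hx, Pi.smul_apply, smul_eq_mul, lpDual_mul, mul_left_comm]

variable [hp₁ : Fact (1 ≤ p)]

lemma integrable_mul_lpDual (hp : p ≠ ∞) (g f : Lp ℂ p μ) :
    Integrable (fun x => g x * lpDual p.toReal (f x)) μ := by
  have hp₀ : p ≠ 0 := (one_pos.trans_le hp₁.out).ne'
  have hq : 1 ≤ p.toReal := by simpa using ENNReal.toReal_mono hp hp₁.out
  refine (((integrable_norm_rpow hp₀ hp g).const_mul p.toReal⁻¹).add
    ((integrable_norm_rpow hp₀ hp f).const_mul (1 - p.toReal⁻¹))).mono'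
    ((Lp.aestronglyMeasurable g).mul ?_) (Eventually.of_forall fun x => norm_mul_lpDual_le hq _ _)
  exact ((measurable_lpDual _).comp_aemeasurable
    (Lp.aestronglyMeasurable f).aemeasurable).aestronglyMeasurable

lemma lpPairing_add_left (hp : p ≠ ∞) (g h f : Lp ℂ p μ) :
    lpPairing (g + h) f = lpPairing g f + lpPairing h f := by
  rw [lpPairing, lpPairing, lpPairing,
    ← integral_add (integrable_mul_lpDual hp g f) (integrable_mul_lpDual hp h f)]
  refine integral_congr_ae ?_
  filter_upwards [Lp.coeFn_add g h] with x hx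
  rw [hx, Pi.add_apply, add_mul]

lemma lpPairing_add_right (hp : p ≠ ∞) (g : Lp ℂ p μ) {u v : Lp ℂ p μ}
    (huv : ∀ᵐ x ∂μ, u x = 0 ∨ v x = 0) :
    lpPairing g (u + v) = lpPairing g u + lpPairing g v := by
  rw [lpPairing, lpPairing, lpPairing,
    ← integral_add (integrable_mul_lpDual hp g u) (integrable_mul_lpDual hp g v)]
  refine integral_congr_ae ?_
  filter_upwards [Lp.coeFn_add u v, huv] with x hx h_zero
  rw [hx, Pi.add_apply]
  rcases h_zero with h_zero | h_zero <;> simp [h_zero]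

lemma re_lpPairing_le (hp : p ≠ ∞) {g f : Lp ℂ p μ} (hgf : ‖g‖ ≤ ‖f‖) :
    (lpPairing g f).re ≤ ‖f‖ ^ p.toReal := by
  have hp₀ : p ≠ 0 := (one_pos.trans_le hp₁.out).ne'
  have hq : 1 ≤ p.toReal := by simpa using ENNReal.toReal_mono hp hp₁.out
  have hg_int := (integrable_norm_rpow hp₀ hp g).const_mul p.toReal⁻¹
  have hf_int := (integrable_norm_rpow hp₀ hp f).const_mul (1 - p.toReal⁻¹)
  calc (lpPairing g f).re ≤ ‖lpPairing g f‖ := Complex.re_le_norm _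
    _ ≤ ∫ x, p.toReal⁻¹ * ‖g x‖ ^ p.toReal + (1 - p.toReal⁻¹) * ‖f x‖ ^ p.toReal ∂μ :=
        norm_integral_le_of_norm_le (hg_int.add hf_int)
          (Eventually.of_forall fun x => norm_mul_lpDual_le hq _ _)
    _ = p.toReal⁻¹ * ‖g‖ ^ p.toReal + (1 - p.toReal⁻¹) * ‖f‖ ^ p.toReal := by
        rw [integral_add hg_int hf_int, integral_const_mul, integral_const_mul,
          norm_rpow_eq_integral hp₀ hp, norm_rpow_eq_integral hp₀ hp]
    _ ≤ p.toReal⁻¹ * ‖f‖ ^ p.toReal + (1 - p.toReal⁻¹) * ‖f‖ ^ p.toReal := by gcongr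
    _ = ‖f‖ ^ p.toReal := by ring

lemma IsHermitianOp.im_lpPairing_apply_self_eq_zero (hp : p ≠ ∞) {T : Lp ℂ p μ →L[ℂ] Lp ℂ p μ}
    (hT : IsHermitianOp T) (f : Lp ℂ p μ) : (lpPairing (T f) f).im = 0 := by
  obtain ⟨C, hC⟩ := hT
  have hp₀ : p ≠ 0 := (one_pos.trans_le hp₁.out).ne'
  refine neg_eq_zero.1 (eq_zero_of_forall_mul_le_sq_mul (D := C * ‖f‖ ^ p.toReal) fun t => ?_)
  set s : ℝ := 1 + (t : ℝ) ^ 2 * C with hs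
  have hs_pos : 0 < s := by positivity
  have h_norm : ‖((s⁻¹ : ℝ) : ℂ) • (f + (((t : ℝ) : ℂ) * Complex.I) • T f)‖ ≤ ‖f‖ := by
    rw [norm_smul, Complex.norm_real, norm_inv, Real.norm_of_nonneg hs_pos.le,
      inv_mul_le_iff₀ hs_pos]
    exact hC t f
  have h_re := re_lpPairing_le hp h_norm
  rw [lpPairing_smul_left, lpPairing_add_left hp, lpPairing_smul_left, lpPairing_self hp₀ hp,
    Complex.re_ofReal_mul, inv_mul_le_iff₀ hs_pos, mul_assoc, Complex.add_re, Complex.ofReal_re,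
    Complex.re_ofReal_mul, Complex.I_mul_re, hs] at h_re
  linarith

lemma IsHermitianOp.lpPairing_apply_eq_zero (hp : p ≠ ∞) (hp₂ : p ≠ 2)
    {T : Lp ℂ p μ →L[ℂ] Lp ℂ p μ} (hT : IsHermitianOp T) {u v : Lp ℂ p μ}
    (huv : ∀ᵐ x ∂μ, u x = 0 ∨ v x = 0) : lpPairing (T v) u = 0 := by
  have hq : p.toReal ≠ 2 := fun h => hp₂ (by rw [← ENNReal.ofReal_toReal hp, h]; simp)
  refine eq_zero_of_forall_im_lpDual_mul_add_eq_zero hq (z := lpPairing (T u) v) fun c => ?_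
  have h_disj : ∀ᵐ x ∂μ, u x = 0 ∨ (c • v) x = 0 := by
    filter_upwards [huv, Lp.coeFn_smul c v] with x hx hcv
    rw [hcv, Pi.smul_apply, smul_eq_zero]
    tauto
  have h_sum := hT.im_lpPairing_apply_self_eq_zero hp (u + c • v)
  have h_diag := hT.im_lpPairing_apply_self_eq_zero hp (c • v)
  rw [map_add, lpPairing_add_left hp, lpPairing_add_right hp _ h_disj,
    lpPairing_add_right hp _ h_disj, Complex.add_im, Complex.add_im, Complex.add_im,
    hT.im_lpPairing_apply_self_eq_zero hp u, h_diag, lpPairing_smul_right, map_smul,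
    lpPairing_smul_left] at h_sum
  rw [Complex.add_im]
  linarith

end LpPairing

section LocalOperatorsOnLp

variable {Ω : Type*} [MeasurableSpace Ω] {μ : Measure Ω} {p : ℝ≥0∞}

lemma measure_eq_zero_of_eLpNorm_indicator_le {F G : Type*} [NormedAddCommGroup F]
    [NormedAddCommGroup G] {f : Ω → F} {g : Ω → G} (hp : p ≠ 0) (hf : MemLp f p μ)
    {A : Set Ω} (hA : MeasurableSet A) {r s : ℝ} (hr : 0 ≤ r) (hrs : r < s)
    (hgA : ∀ x ∈ A, ‖g x‖ ≤ r) (hfA : ∀ x ∈ A, s ≤ ‖f x‖)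
    (h : eLpNorm (A.indicator f) p μ ≤ eLpNorm (A.indicator g) p μ) : μ A = 0 := by
  have hs : 0 < s := hr.trans_lt hrs
  set χ : Ω → ℝ := A.indicator 1
  have h_lower : eLpNorm (s • χ) p μ ≤ eLpNorm (A.indicator f) p μ := by
    refine eLpNorm_mono fun x => ?_
    by_cases hx : x ∈ A
    · simpa [χ, hx, abs_of_pos hs] using hfA x hx
    · simp [χ, hx]
  have h_upper : eLpNorm (A.indicator g) p μ ≤ eLpNorm (r • χ) p μ := by
    refine eLpNorm_mono fun x => ?_
    by_cases hx : x ∈ A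
    · simpa [χ, hx, abs_of_nonneg hr] using hgA x hx
    · simp [χ, hx]
  have h_le := (h_lower.trans h).trans h_upper
  have h_fin := h_lower.trans_lt (hf.indicator hA).2
  rw [eLpNorm_const_smul] at h_fin
  rw [eLpNorm_const_smul, eLpNorm_const_smul] at h_le
  have hχ : eLpNorm χ p μ = 0 := by
    by_contra h_ne
    have hχ_fin : eLpNorm χ p μ ≠ ∞ := fun h_top => by
      rw [h_top, ENNReal.mul_top (enorm_ne_zero.2 hs.ne')] at h_fin
      exact h_fin.ne rfl
    rw [ENNReal.mul_le_mul_iff_left h_ne hχ_fin, enorm_le_iff_norm_le, Real.norm_of_nonneg hr,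
      Real.norm_of_nonneg hs.le] at h_le
    exact h_le.not_gt hrs
  rw [eLpNorm_eq_zero_iff (stronglyMeasurable_one.indicator hA).aestronglyMeasurable hp,
    Set.indicator_ae_eq_zero, Function.support_one, Set.inter_univ] at hχ
  exact hχ

lemma ae_norm_le_of_forall_eLpNorm_indicator_le {F G : Type*} [NormedAddCommGroup F]
    [NormedAddCommGroup G] {f : Ω → F} {g : Ω → G} (hp : p ≠ 0) (hf_meas : StronglyMeasurable f)
    (hf : MemLp f p μ) (hg : StronglyMeasurable g)
    (h : ∀ A, MeasurableSet A → eLpNorm (A.indicator f) p μ ≤ eLpNorm (A.indicator g) p μ) :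
    ∀ᵐ x ∂μ, ‖f x‖ ≤ ‖g x‖ := by
  have h_rat : ∀ᵐ x ∂μ, ∀ r s : ℚ, 0 ≤ r → r < s → ¬ (‖g x‖ ≤ r ∧ s ≤ ‖f x‖) := by
    simp only [ae_all_iff]
    intro r s hr hrs
    have hA : MeasurableSet {x | ‖g x‖ ≤ r ∧ s ≤ ‖f x‖} :=
      (hg.norm.measurable measurableSet_Iic).inter (hf_meas.norm.measurable measurableSet_Ici)
    exact measure_eq_zero_iff_ae_notMem.1 (measure_eq_zero_of_eLpNorm_indicator_le hp hf hA
      (mod_cast hr) (Rat.cast_lt.2 hrs) (fun x hx => hx.1) (fun x hx => hx.2) (h _ hA))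
  filter_upwards [h_rat] with x hx
  by_contra! h_lt
  obtain ⟨r, hgr, hrf⟩ := exists_rat_btwn h_lt
  obtain ⟨s, hrs, hsf⟩ := exists_rat_btwn hrf
  exact hx r s (mod_cast (norm_nonneg _).trans hgr.le) (mod_cast hrs) ⟨hgr.le, hsf.le⟩

variable {𝕜 : Type*} [RCLike 𝕜] [hp₁ : Fact (1 ≤ p)]

/-- An operator on `L^p` is local if it does not enlarge supports. -/
def IsLocalOnLp (T : Lp 𝕜 p μ →L[𝕜] Lp 𝕜 p μ) : Prop :=
  ∀ ξ : Lp 𝕜 p μ, ∀ᵐ x ∂μ, ξ x = 0 → T ξ x = 0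

lemma IsLocalOnLp.apply_toLp_indicator {T : Lp 𝕜 p μ →L[𝕜] Lp 𝕜 p μ} (hT : IsLocalOnLp T)
    {A : Set Ω} (hA : MeasurableSet A) (ξ : Lp 𝕜 p μ) :
    T (((Lp.memLp ξ).indicator hA).toLp) =ᵐ[μ] A.indicator (T ξ) := by
  set ζ : Lp 𝕜 p μ := ((Lp.memLp ξ).indicator hA).toLp
  have h_sub := hT (ξ - ζ)
  rw [map_sub] at h_sub
  filter_upwards [hT ζ, h_sub, ((Lp.memLp ξ).indicator hA).coeFn_toLp, Lp.coeFn_sub ξ ζ,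
    Lp.coeFn_sub (T ξ) (T ζ)] with x h_off h_on hζ h_sub₁ h_sub₂
  by_cases hx : x ∈ A
  · rw [h_sub₁, h_sub₂, Pi.sub_apply, Pi.sub_apply, hζ, Set.indicator_of_mem hx, sub_self,
      sub_eq_zero] at h_on
    rw [Set.indicator_of_mem hx, h_on rfl]
  · rw [Set.indicator_of_notMem hx] at hζ ⊢
    exact h_off hζ

lemma IsLocalOnLp.ae_norm_smul_add_smul_le {T : Lp 𝕜 p μ →L[𝕜] Lp 𝕜 p μ} (hT : IsLocalOnLp T)
    {c d : 𝕜} {C : ℝ} (hC : 0 ≤ C) (h : ∀ ξ, ‖c • T ξ + d • ξ‖ ≤ C * ‖ξ‖) (ξ : Lp 𝕜 p μ) :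
    ∀ᵐ x ∂μ, ‖c * T ξ x + d * ξ x‖ ≤ C * ‖ξ x‖ := by
  have hp₀ : p ≠ 0 := (one_pos.trans_le hp₁.out).ne'
  have h_dom := ae_norm_le_of_forall_eLpNorm_indicator_le (f := c • ⇑(T ξ) + d • ⇑ξ)
    (g := C • ⇑ξ) hp₀
    (((Lp.stronglyMeasurable (T ξ)).const_smul c).add ((Lp.stronglyMeasurable ξ).const_smul d))
    (((Lp.memLp (T ξ)).const_smul c).add ((Lp.memLp ξ).const_smul d))
    ((Lp.stronglyMeasurable ξ).const_smul C) fun A hA => ?_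
  · filter_upwards [h_dom] with x hx
    simpa [norm_smul, abs_of_nonneg hC] using hx
  set ζ : Lp 𝕜 p μ := ((Lp.memLp ξ).indicator hA).toLp
  have hζ : ζ =ᵐ[μ] A.indicator ξ := ((Lp.memLp ξ).indicator hA).coeFn_toLp
  have h_left : eLpNorm (A.indicator (c • ⇑(T ξ) + d • ⇑ξ)) p μ = ‖c • T ζ + d • ζ‖ₑ := by
    rw [Lp.enorm_def]
    refine eLpNorm_congr_ae ?_
    filter_upwards [hζ, hT.apply_toLp_indicator hA ξ, Lp.coeFn_add (c • T ζ) (d • ζ),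
      Lp.coeFn_smul c (T ζ), Lp.coeFn_smul d ζ] with x h₁ h₂ h₃ h₄ h₅
    rw [h₃, Pi.add_apply, h₄, h₅, Pi.smul_apply, Pi.smul_apply, h₁, h₂]
    by_cases hx : x ∈ A <;> simp [hx]
  have h_right : eLpNorm (A.indicator (C • ⇑ξ)) p μ = ‖C • ζ‖ₑ := by
    rw [Lp.enorm_def]
    refine eLpNorm_congr_ae ?_
    filter_upwards [hζ, Lp.coeFn_smul C ζ] with x h₁ h₂
    rw [h₂, Pi.smul_apply, h₁]
    by_cases hx : x ∈ A <;> simp [hx]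
  rw [h_left, h_right, enorm_le_iff_norm_le, norm_smul, Real.norm_of_nonneg hC]
  exact h ζ

lemma IsLocalOnLp.ae_norm_apply_le {T : Lp 𝕜 p μ →L[𝕜] Lp 𝕜 p μ} (hT : IsLocalOnLp T)
    {C : ℝ} (hC : 0 ≤ C) (hTC : ∀ ξ, ‖T ξ‖ ≤ C * ‖ξ‖) (ξ : Lp 𝕜 p μ) :
    ∀ᵐ x ∂μ, ‖T ξ x‖ ≤ C * ‖ξ x‖ := by
  simpa using hT.ae_norm_smul_add_smul_le (c := 1) (d := 0) hC (by simpa using hTC) ξ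

lemma IsLocalOnLp.ae_mul_eq_mul {T : Lp 𝕜 p μ →L[𝕜] Lp 𝕜 p μ} (hT : IsLocalOnLp T)
    (ξ η : Lp 𝕜 p μ) : ∀ᵐ x ∂μ, T ξ x * η x = ξ x * T η x := by
  have h_seq : ∀ᵐ x ∂μ, ∀ n : ℕ, ‖T ξ x - TopologicalSpace.denseSeq 𝕜 n * T η x‖ ≤
      ‖T‖ * ‖ξ x - TopologicalSpace.denseSeq 𝕜 n * η x‖ := by
    refine ae_all_iff.2 fun n => ?_
    set c := TopologicalSpace.denseSeq 𝕜 n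
    have h := hT.ae_norm_apply_le (norm_nonneg T) T.le_opNorm (ξ - c • η)
    rw [map_sub, map_smul] at h
    filter_upwards [h, Lp.coeFn_sub ξ (c • η), Lp.coeFn_sub (T ξ) (c • T η),
      Lp.coeFn_smul c η, Lp.coeFn_smul c (T η)] with x hx h₁ h₂ h₃ h₄
    rwa [h₁, h₂, Pi.sub_apply, Pi.sub_apply, h₃, h₄] at hx
  filter_upwards [h_seq, hT η] with x hx hη
  have h_all (c : 𝕜) : ‖T ξ x - c * T η x‖ ≤ ‖T‖ * ‖ξ x - c * η x‖ :=
    (TopologicalSpace.denseRange_denseSeq 𝕜).induction_on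
      (p := fun c => ‖T ξ x - c * T η x‖ ≤ ‖T‖ * ‖ξ x - c * η x‖) c
      (isClosed_le (by fun_prop) (by fun_prop)) hx
  by_cases h_zero : η x = 0
  · rw [h_zero, hη h_zero, mul_zero, mul_zero]
  · have h := h_all (ξ x / η x)
    rw [div_mul_cancel₀ _ h_zero, sub_self, norm_zero, mul_zero, norm_le_zero_iff,
      sub_eq_zero] at h
    rw [h, mul_right_comm, div_mul_cancel₀ _ h_zero]

end LocalOperatorsOnLp

section HermitianOperatorsOnLp

variable {Ω : Type*} [MeasurableSpace Ω] {μ : Measure Ω}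

lemma ae_norm_apply_le_norm {F : Type*} [NormedAddCommGroup F] (f : Lp F ∞ μ) :
    ∀ᵐ x ∂μ, ‖f x‖ ≤ ‖f‖ := by
  filter_upwards [ae_le_eLpNormEssSup (f := f) (μ := μ)] with x hx
  rw [← eLpNorm_exponent_top, ← Lp.enorm_def] at hx
  exact enorm_le_iff_norm_le.1 hx

lemma measurableSet_apply_eq_zero {F : Type*} [NormedAddCommGroup F] {p : ℝ≥0∞} (f : Lp F p μ) :
    MeasurableSet {x | f x = 0} :=
  (Lp.stronglyMeasurable f).measurableSet_eq_fun stronglyMeasurable_const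

lemma IsHermitianOp.ae_im_apply_eq_zero {T : Lp ℂ ∞ μ →L[ℂ] Lp ℂ ∞ μ} (hT : IsHermitianOp T)
    {f : Lp ℂ ∞ μ} (hf : ‖f‖ ≤ 1) : ∀ᵐ x ∂μ, f x = 1 → (T f x).im = 0 := by
  obtain ⟨C, hC⟩ := hT
  have h_rat : ∀ᵐ x ∂μ, ∀ t : ℚ,
      ‖f x + ((t : ℝ) : ℂ) * Complex.I * T f x‖ ≤ 1 + (t : ℝ) ^ 2 * C := by
    refine ae_all_iff.2 fun t => ?_
    have h_norm : ‖f + (((t : ℝ) : ℂ) * Complex.I) • T f‖ ≤ 1 + (t : ℝ) ^ 2 * C :=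
      (hC t f).trans (mul_le_of_le_one_right (by positivity) hf)
    filter_upwards [ae_norm_apply_le_norm (f + (((t : ℝ) : ℂ) * Complex.I) • T f),
      Lp.coeFn_add f ((((t : ℝ) : ℂ) * Complex.I) • T f),
      Lp.coeFn_smul (((t : ℝ) : ℂ) * Complex.I) (T f)] with x h_le h_add h_smul
    rw [h_add, Pi.add_apply, h_smul] at h_le
    exact h_le.trans h_norm
  filter_upwards [h_rat] with x hx hfx
  refine im_eq_zero_of_forall_norm_add_le (w := 1) (C := C) fun t => ?_
  rw [mul_one, Complex.ofReal_one, ← hfx]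
  exact hx t

lemma IsHermitianOp.ae_im_apply_add_mul_eq_zero {T : Lp ℂ ∞ μ →L[ℂ] Lp ℂ ∞ μ}
    (hT : IsHermitianOp T) {χ ξ : Lp ℂ ∞ μ} (hχ : χ =ᵐ[μ] {x | ξ x = 0}.indicator 1)
    {c : ℂ} (hc : ‖c‖ * ‖ξ‖ ≤ 1) : ∀ᵐ x ∂μ, ξ x = 0 → (T χ x + c * T ξ x).im = 0 := by
  have h_eq : ∀ᵐ x ∂μ, (χ + c • ξ) x = {x | ξ x = 0}.indicator 1 x + c * ξ x := by
    filter_upwards [hχ, Lp.coeFn_add χ (c • ξ), Lp.coeFn_smul c ξ] with x h₁ h₂ h₃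
    rw [h₂, Pi.add_apply, h₁, h₃]
    rfl
  have h_bound : ∀ᵐ x ∂μ, ‖(χ + c • ξ) x‖ ≤ 1 := by
    filter_upwards [h_eq, ae_norm_apply_le_norm ξ] with x hx hξ
    rw [hx]
    by_cases h_zero : ξ x = 0
    · simp [h_zero]
    · simpa [Set.indicator, h_zero] using
        (mul_le_mul_of_nonneg_left hξ (norm_nonneg c)).trans hc
  have h_norm : ‖χ + c • ξ‖ ≤ 1 := by
    rw [Lp.norm_def, eLpNorm_exponent_top]
    exact ENNReal.toReal_le_of_le_ofReal zero_le_one (eLpNormEssSup_le_of_ae_bound h_bound)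
  filter_upwards [hT.ae_im_apply_eq_zero h_norm, h_eq, Lp.coeFn_add (T χ) (c • T ξ),
    Lp.coeFn_smul c (T ξ)] with x h_zero hx h_add h_smul hξ
  rw [hx, map_add, map_smul, h_add, Pi.add_apply, h_smul] at h_zero
  exact h_zero (by simp [hξ])

lemma IsHermitianOp.isLocalOnLp_top {T : Lp ℂ ∞ μ →L[ℂ] Lp ℂ ∞ μ} (hT : IsHermitianOp T) :
    IsLocalOnLp T := by
  intro ξ
  have hχ := ((memLp_top_const (1 : ℂ)).indicator
    (measurableSet_apply_eq_zero ξ)).coeFn_toLp (μ := μ)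
  have h_im {c : ℂ} (hc : ‖c‖ * ‖ξ‖ ≤ 1) := hT.ae_im_apply_add_mul_eq_zero hχ hc
  have hr : 0 < (‖ξ‖ + 1)⁻¹ := by positivity
  have hr_le : (‖ξ‖ + 1)⁻¹ * ‖ξ‖ ≤ 1 := by
    rw [inv_mul_le_iff₀ (by positivity)]
    linarith
  set r := (‖ξ‖ + 1)⁻¹
  filter_upwards [h_im (c := r) (by simpa [abs_of_pos hr]),
    h_im (c := -r) (by simpa [abs_of_pos hr]),
    h_im (c := r * Complex.I) (by simpa [abs_of_pos hr])] with x h_pos h_neg h_I hx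
  exact eq_zero_of_im_add_mul_eq_zero hr.ne' (h_pos hx) (h_neg hx) (h_I hx)

variable {p : ℝ≥0∞} [hp₁ : Fact (1 ≤ p)]

lemma IsHermitianOp.isLocalOnLp_of_ne_top (hp : p ≠ ∞) (hp₂ : p ≠ 2)
    {T : Lp ℂ p μ →L[ℂ] Lp ℂ p μ} (hT : IsHermitianOp T) : IsLocalOnLp T := by
  intro ξ
  have hp₀ : p ≠ 0 := (one_pos.trans_le hp₁.out).ne'
  have hA := measurableSet_apply_eq_zero ξ
  set u : Lp ℂ p μ := ((Lp.memLp (T ξ)).indicator hA).toLp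
  have hu : u =ᵐ[μ] {x | ξ x = 0}.indicator (T ξ) := MemLp.coeFn_toLp _
  have h_disj : ∀ᵐ x ∂μ, u x = 0 ∨ ξ x = 0 := by
    filter_upwards [hu] with x hx
    rw [hx, Set.indicator_apply_eq_zero]
    exact or_iff_not_imp_right.2 fun h_ne h_eq => absurd h_eq h_ne
  have h_pairing : lpPairing (T ξ) u = lpPairing u u := by
    refine lpPairing_congr_left ?_
    filter_upwards [hu] with x hx h_ne
    rw [hx, Set.indicator_apply_ne_zero] at h_ne
    rw [hx, Set.indicator_of_mem h_ne.1]
  rw [hT.lpPairing_apply_eq_zero hp hp₂ h_disj, lpPairing_self hp₀ hp, eq_comm,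
    Complex.ofReal_eq_zero, Real.rpow_eq_zero (norm_nonneg u) (ENNReal.toReal_pos hp₀ hp).ne',
    norm_eq_zero, Lp.eq_zero_iff_ae_eq_zero] at h_pairing
  filter_upwards [hu, h_pairing] with x hx h_zero hξ
  rw [← Set.indicator_of_mem (s := {x | ξ x = 0}) hξ (T ξ), ← hx, h_zero, Pi.zero_apply]

lemma IsHermitianOp.isLocalOnLp (hp : p ≠ 2) {T : Lp ℂ p μ →L[ℂ] Lp ℂ p μ}
    (hT : IsHermitianOp T) : IsLocalOnLp T := by
  rcases eq_or_ne p ∞ with rfl | h_top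
  · exact hT.isLocalOnLp_top
  · exact hT.isLocalOnLp_of_ne_top h_top hp

lemma IsNondegenerate.isPositiveOnLp_of_ne_two {X : Type*} [TopologicalSpace X] (hp : p ≠ 2)
    {π : C₀(X, ℂ) →ₙₐ[ℂ] (Lp ℂ p μ →L[ℂ] Lp ℂ p μ)} (hnd : IsNondegenerate π)
    (hπ : IsContractive π) {a : C₀(X, ℂ)} (ha : ∀ x, 0 ≤ a x) : IsPositiveOnLp (π a) := by
  have h_herm := hnd.isHermitianOp hπ fun x => (Complex.nonneg_iff.1 (ha x)).2.symm
  have h_local := h_herm.isLocalOnLp hp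
  obtain ⟨C, hC⟩ := h_herm
  intro ξ hξ
  have h_sub := h_local.ae_norm_smul_add_smul_le (c := 1) (d := -((‖a‖ / 2 : ℝ) : ℂ))
    (C := ‖a‖ / 2) (by positivity) (fun η => by
      simpa only [one_smul] using hnd.norm_apply_add_neg_smul_le hπ ha η) ξ
  have h_add (t : ℚ) := h_local.ae_norm_smul_add_smul_le (c := ((t : ℝ) : ℂ) * Complex.I) (d := 1)
    (C := 1 + (t : ℝ) ^ 2 * C) (by positivity)
    (fun η => by simpa only [one_smul, add_comm] using hC t η) ξ
  filter_upwards [hξ, h_sub, ae_all_iff.2 h_add] with x hx hx_sub hx_add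
  refine nonneg_of_norm_sub_le_of_forall_norm_add_le hx (r := ‖a‖ / 2) (C := C) ?_ fun t => ?_
  · simpa only [one_mul, neg_mul, ← sub_eq_add_neg] using hx_sub
  · simpa only [one_mul, add_comm] using hx_add t

end HermitianOperatorsOnLp

section LocalOperatorsOnC0

variable {𝕜 Y : Type*} [RCLike 𝕜] [TopologicalSpace Y]

/-- An operator on `C₀(Y)` is local if it preserves the zeros of functions. -/
def IsLocalOnC0 (T : C₀(Y, 𝕜) →L[𝕜] C₀(Y, 𝕜)) : Prop :=
  ∀ (ξ : C₀(Y, 𝕜)) (y : Y), ξ y = 0 → T ξ y = 0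

lemma IsLocalOnC0.apply_eq_mul {T : C₀(Y, 𝕜) →L[𝕜] C₀(Y, 𝕜)} (hT : IsLocalOnC0 T)
    {g : C₀(Y, 𝕜)} {y : Y} (hg : g y = 1) (ξ : C₀(Y, 𝕜)) : T ξ y = ξ y * T g y := by
  have h := hT (ξ - ξ y • g) y (by simp [hg])
  rwa [map_sub, map_smul, ZeroAtInftyContinuousMap.sub_apply, sub_eq_zero] at h

lemma IsLocalOnC0.norm_smul_add_smul_le {T : C₀(Y, 𝕜) →L[𝕜] C₀(Y, 𝕜)} (hT : IsLocalOnC0 T)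
    {c d : 𝕜} {C : ℝ} (hC : 0 ≤ C) (h : ∀ ξ, ‖c • T ξ + d • ξ‖ ≤ C * ‖ξ‖) (ξ : C₀(Y, 𝕜)) (y : Y) :
    ‖c * T ξ y + d * ξ y‖ ≤ C * ‖ξ y‖ := by
  by_cases hξ : ξ y = 0
  · simp [hξ, hT ξ y hξ]
  obtain ⟨g, hgy, hg⟩ := exists_zeroAtInfty_apply_eq_one hξ
  calc ‖c * T ξ y + d * ξ y‖ = ‖(c • T g + d • g) y‖ * ‖ξ y‖ := by
        rw [← norm_mul, hT.apply_eq_mul hgy, ZeroAtInftyContinuousMap.add_apply,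
          ZeroAtInftyContinuousMap.smul_apply, ZeroAtInftyContinuousMap.smul_apply, hgy,
          smul_eq_mul, smul_eq_mul]
        ring_nf
    _ ≤ C * ‖ξ y‖ := by
        gcongr
        exact (zeroAtInfty_norm_apply_le _ y).trans ((h g).trans (mul_le_of_le_one_right hC hg))

lemma IsLocalOnC0.exists_multiplier {T : C₀(Y, 𝕜) →L[𝕜] C₀(Y, 𝕜)} (hT : IsLocalOnC0 T)
    (hY : ∀ y, ∃ f : C₀(Y, 𝕜), f y ≠ 0) :
    ∃ h : Y →ᵇ 𝕜, ‖h‖ ≤ ‖T‖ ∧ ∀ ξ y, T ξ y = h y * ξ y := by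
  have hY' (y : Y) : ∃ g : C₀(Y, 𝕜), g y = 1 ∧ ‖g‖ ≤ 1 :=
    exists_zeroAtInfty_apply_eq_one (hY y).choose_spec
  choose g hgy hg using hY'
  let h (y : Y) : 𝕜 := T (g y) y
  have h_mul (ξ : C₀(Y, 𝕜)) (y : Y) : T ξ y = h y * ξ y := by
    rw [hT.apply_eq_mul (hgy y), mul_comm]
  have h_norm (y : Y) : ‖h y‖ ≤ ‖T‖ :=
    (zeroAtInfty_norm_apply_le _ y).trans (T.unit_le_opNorm _ (hg y))
  have h_cont : Continuous h := by
    refine continuous_iff_continuousAt.2 fun y => ?_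
    have h_ne : ∀ᶠ z in 𝓝 y, g y z ≠ 0 :=
      (map_continuous (g y)).continuousAt.eventually_ne (by simp [hgy])
    refine (((map_continuous (T (g y))).continuousAt.div (map_continuous (g y)).continuousAt
      (by simp [hgy])).congr ?_)
    filter_upwards [h_ne] with z hz
    rw [Pi.div_apply, h_mul, mul_div_cancel_right₀ _ hz]
  exact ⟨BoundedContinuousFunction.ofNormedAddCommGroup h h_cont ‖T‖ h_norm,
    BoundedContinuousFunction.norm_ofNormedAddCommGroup_le _ (norm_nonneg T) h_norm, h_mul⟩

lemma IsContractive.exists_multiplier_C0 {X : Type*} [TopologicalSpace X]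
    (hY : ∀ y, ∃ f : C₀(Y, 𝕜), f y ≠ 0) {π : C₀(X, 𝕜) →ₙₐ[𝕜] (C₀(Y, 𝕜) →L[𝕜] C₀(Y, 𝕜))}
    (hπ : IsContractive π) (h_local : ∀ a, IsLocalOnC0 (π a)) :
    ∃ π₀ : C₀(X, 𝕜) →ₙₐ[𝕜] (Y →ᵇ 𝕜), IsContractive π₀ ∧ ∀ a ξ y, π a ξ y = π₀ a y * ξ y := by
  choose h h_norm h_mul using fun a => (h_local a).exists_multiplier hY
  have h_unique {b : C₀(X, 𝕜)} {k : Y →ᵇ 𝕜} (hk : ∀ ξ y, π b ξ y = k y * ξ y) : h b = k := by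
    ext y
    obtain ⟨f, hf⟩ := hY y
    exact mul_right_cancel₀ hf ((h_mul b f y).symm.trans (hk f y))
  refine ⟨{ toFun := h
            map_smul' := fun c a => h_unique fun ξ y => ?_
            map_zero' := h_unique fun ξ y => ?_
            map_add' := fun a b => h_unique fun ξ y => ?_
            map_mul' := fun a b => h_unique fun ξ y => ?_ },
    fun a => (h_norm a).trans (hπ a), h_mul⟩
  · simp [h_mul, mul_assoc]
  · simp
  · simp [h_mul, add_mul]
  · simp [h_mul, mul_assoc]

end LocalOperatorsOnC0

section HermitianOperatorsOnC0

variable {Y : Type*} [TopologicalSpace Y]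

lemma IsHermitianOp.im_apply_eq_zero_of_apply_eq_one {T : C₀(Y, ℂ) →L[ℂ] C₀(Y, ℂ)}
    (hT : IsHermitianOp T) {f : C₀(Y, ℂ)} (hf : ‖f‖ ≤ 1) {y : Y} (hy : f y = 1) :
    (T f y).im = 0 := by
  obtain ⟨C, hC⟩ := hT
  refine im_eq_zero_of_forall_norm_add_le (w := 1) (C := C) fun t => ?_
  rw [Complex.ofReal_one, ← hy, mul_one]
  exact (zeroAtInfty_norm_apply_le (f + (((t : ℝ) : ℂ) * Complex.I) • T f) y).trans
    ((hC t f).trans (mul_le_of_le_one_right (by positivity) hf))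

lemma IsHermitianOp.isLocalOnC0 {T : C₀(Y, ℂ) →L[ℂ] C₀(Y, ℂ)} (hT : IsHermitianOp T) :
    IsLocalOnC0 T := by
  intro ξ y hξ
  by_contra h_ne
  obtain ⟨g, hgy, hg⟩ := exists_zeroAtInfty_apply_eq_one h_ne
  have hr : 0 < (‖ξ‖ + 1)⁻¹ := by positivity
  have hr_le : (‖ξ‖ + 1)⁻¹ * ‖ξ‖ ≤ 1 := by
    rw [inv_mul_le_iff₀ (by positivity)]
    linarith
  set r := (‖ξ‖ + 1)⁻¹
  let η : C₀(Y, ℂ) := zeroAtInftyPostcomp ⟨fun z => ((‖z‖ : ℝ) : ℂ), by fun_prop⟩ (by simp) ξ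
  let u : C₀(Y, ℂ) := g - (r : ℂ) • (η * g)
  have hu (z : Y) : u z = ((1 - r * ‖ξ z‖ : ℝ) : ℂ) * g z := by
    simp [u, η]
    ring
  have h_im {c : ℂ} (hc : ‖c‖ = r) : (T u y + c * T ξ y).im = 0 := by
    have h_norm : ‖u + c • ξ‖ ≤ 1 := by
      refine (zeroAtInfty_norm_le zero_le_one).2 fun z => ?_
      have hξz : r * ‖ξ z‖ ≤ 1 :=
        (mul_le_mul_of_nonneg_left (zeroAtInfty_norm_apply_le ξ z) hr.le).trans hr_le
      have hgz := (zeroAtInfty_norm_apply_le g z).trans hg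
      calc ‖u z + c * ξ z‖ ≤ ‖u z‖ + ‖c * ξ z‖ := norm_add_le _ _
        _ = (1 - r * ‖ξ z‖) * ‖g z‖ + r * ‖ξ z‖ := by
            rw [hu, norm_mul, norm_mul, hc, Complex.norm_of_nonneg (sub_nonneg.2 hξz)]
        _ ≤ 1 := by nlinarith
    have := hT.im_apply_eq_zero_of_apply_eq_one h_norm (y := y) (by simp [hu, hξ, hgy])
    rwa [map_add, map_smul] at this
  exact h_ne (eq_zero_of_im_add_mul_eq_zero hr.ne' (h_im (by simp [abs_of_pos hr]))
    (h_im (by simp [abs_of_pos hr])) (h_im (by simp [abs_of_pos hr])))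

lemma IsNondegenerate.isPositiveOnC0 {X : Type*} [TopologicalSpace X]
    {π : C₀(X, ℂ) →ₙₐ[ℂ] (C₀(Y, ℂ) →L[ℂ] C₀(Y, ℂ))} (hnd : IsNondegenerate π)
    (hπ : IsContractive π) {a : C₀(X, ℂ)} (ha : ∀ x, 0 ≤ a x) : IsPositiveOnC0 (π a) := by
  have h_herm := hnd.isHermitianOp hπ fun x => (Complex.nonneg_iff.1 (ha x)).2.symm
  have h_local := h_herm.isLocalOnC0
  obtain ⟨C, hC⟩ := h_herm
  intro ξ hξ y
  refine nonneg_of_norm_sub_le_of_forall_norm_add_le (hξ y) (r := ‖a‖ / 2) (C := C) ?_ fun t => ?_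
  · have h := h_local.norm_smul_add_smul_le (c := 1) (d := -((‖a‖ / 2 : ℝ) : ℂ)) (C := ‖a‖ / 2)
      (by positivity) (fun η => by
        simpa only [one_smul] using hnd.norm_apply_add_neg_smul_le hπ ha η) ξ y
    simpa only [one_mul, neg_mul, ← sub_eq_add_neg] using h
  · have h := h_local.norm_smul_add_smul_le (c := ((t : ℝ) : ℂ) * Complex.I) (d := 1)
      (C := 1 + (t : ℝ) ^ 2 * C) (by positivity)
      (fun η => by simpa only [one_smul, add_comm] using hC t η) ξ y
    simpa only [one_mul, add_comm] using h

end HermitianOperatorsOnC0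

section LocalizableMeasure

variable {Ω : Type*} [MeasurableSpace Ω] {μ : Measure Ω}

lemma IsLocalizable.ae_of_forall_measure_lt_top (hμ : IsLocalizable μ) {P : Ω → Prop}
    (hP : MeasurableSet {x | P x})
    (h : ∀ A, MeasurableSet A → μ A < ∞ → ∀ᵐ x ∂μ, x ∈ A → P x) : ∀ᵐ x ∂μ, P x := by
  by_contra h_ne
  obtain ⟨A, hA_sub, hA, hA_pos, hA_lt⟩ :
      ∃ A ⊆ {x | P x}ᶜ, MeasurableSet A ∧ 0 < μ A ∧ μ A < ∞ := by
    rcases (le_top : μ {x | P x}ᶜ ≤ ∞).lt_or_eq with h_lt | h_top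
    · exact ⟨_, subset_rfl, hP.compl, pos_iff_ne_zero.2 h_ne, h_lt⟩
    · exact hμ.semifinite _ hP.compl h_top
  refine hA_pos.ne' (measure_eq_zero_iff_ae_notMem.2 ?_)
  filter_upwards [h A hA hA_lt] with x hx hxA
  exact hA_sub hxA (hx hxA)

lemma IsLocalizable.exists_measurableSet_glue (hμ : IsLocalizable μ) {ι : Type*} {A B : ι → Set Ω}
    (hA : ∀ i, MeasurableSet (A i)) (hB : ∀ i, MeasurableSet (B i))
    (h_compat : ∀ i j, ∀ᵐ x ∂μ, x ∈ A i → x ∈ A j → (x ∈ B i ↔ x ∈ B j)) :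
    ∃ S, MeasurableSet S ∧ ∀ i, ∀ᵐ x ∂μ, x ∈ A i → (x ∈ S ↔ x ∈ B i) := by
  have ae_sdiff {s t : Set Ω} : μ (s \ t) = 0 ↔ ∀ᵐ x ∂μ, x ∈ s → x ∈ t := by
    simp [measure_eq_zero_iff_ae_notMem]
  obtain ⟨S, hS, hS_upper, hS_least⟩ := hμ.exists_essSup (Set.range fun i => A i ∩ B i) (by
    rintro _ ⟨i, rfl⟩
    exact (hA i).inter (hB i))
  simp only [Set.forall_mem_range, ae_sdiff] at hS_upper hS_least
  refine ⟨S, hS, fun i => ?_⟩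
  -- By compatibility, removing `A i \ B i` from `S` leaves an upper bound of all `A j ∩ B j`.
  have h_least := hS_least (S \ (A i \ B i)) (hS.diff ((hA i).diff (hB i))) fun j => by
    filter_upwards [hS_upper j, h_compat i j] with x hxS h_iff hxj
    exact ⟨hxS hxj, fun hxi => hxi.2 ((h_iff hxi.1 hxj.1).2 hxj.2)⟩
  filter_upwards [hS_upper i, h_least] with x h_upper h_diff hxA
  refine ⟨fun hxS => ?_, fun hxB => h_upper ⟨hxA, hxB⟩⟩
  by_contra hxB
  exact (h_diff hxS).2 ⟨hxA, hxB⟩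

lemma IsLocalizable.exists_measurable_glue (hμ : IsLocalizable μ) {ι β : Type*} [Nonempty β]
    [MeasurableSpace β] [StandardBorelSpace β] {A : ι → Set Ω} (hA : ∀ i, MeasurableSet (A i))
    {f : ι → Ω → β} (hf : ∀ i, Measurable (f i))
    (h_compat : ∀ i j, ∀ᵐ x ∂μ, x ∈ A i → x ∈ A j → f i x = f j x) :
    ∃ g : Ω → β, Measurable g ∧ ∀ i, ∀ᵐ x ∂μ, x ∈ A i → g x = f i x := by
  classical
  -- Embedding `β` into `ℕ → Bool` reduces the claim to gluing countably many sets.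
  obtain ⟨e, he, he_inj⟩ := MeasurableSpace.measurable_injection_nat_bool_of_countablySeparated β
  obtain ⟨r, hr, hre⟩ := (he.measurableEmbedding he_inj).exists_measurable_extend
    measurable_id fun _ => ‹Nonempty β›
  have hB (n : ℕ) : MeasurableSet {z | e z n = true} :=
    (measurable_pi_iff.1 he n) (measurableSet_singleton true)
  choose S hS hSf using fun n => hμ.exists_measurableSet_glue hA
    (B := fun i => f i ⁻¹' {z | e z n = true}) (fun i => hf i (hB n)) fun i j => by
      filter_upwards [h_compat i j] with x hx hxi hxj
      rw [Set.mem_preimage, Set.mem_preimage, hx hxi hxj]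
  refine ⟨fun x => r fun n => decide (x ∈ S n),
    hr.comp (measurable_pi_lambda _ fun n => measurable_to_bool (by
      simpa [Set.preimage] using hS n)), fun i => ?_⟩
  filter_upwards [ae_all_iff.2 fun n => hSf n i] with x hx hxi
  have h_code : (fun n => decide (x ∈ S n)) = e (f i x) := by
    ext n
    simp [hx n hxi]
  rw [h_code]
  exact congrFun hre (f i x)

end LocalizableMeasure

section MultipliersOnLp

variable {Ω 𝕜 : Type*} [MeasurableSpace Ω] {μ : Measure Ω} [RCLike 𝕜] {p : ℝ≥0∞}

lemma IsLocalizable.eq_of_forall_ae_mul_eq_mul (hμ : IsLocalizable μ) {h k : Lp 𝕜 ∞ μ}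
    (h_eq : ∀ ξ : Lp 𝕜 p μ, ∀ᵐ x ∂μ, h x * ξ x = k x * ξ x) : h = k := by
  refine Lp.ext (hμ.ae_of_forall_measure_lt_top (measurableSet_eq_fun
    (Lp.stronglyMeasurable h).measurable (Lp.stronglyMeasurable k).measurable) fun A hA hA_lt => ?_)
  filter_upwards [h_eq (indicatorConstLp p hA hA_lt.ne 1),
    indicatorConstLp_coeFn_mem (p := p) (hs := hA) (hμs := hA_lt.ne) (c := (1 : 𝕜))]
    with x hx h_one hxA
  simpa only [h_one hxA, mul_one] using hx

variable [Fact (1 ≤ p)]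

lemma IsLocalOnLp.exists_measurable_multiplier (hμ : IsLocalizable μ)
    {T : Lp 𝕜 p μ →L[𝕜] Lp 𝕜 p μ} (hT : IsLocalOnLp T) :
    ∃ h : Ω → 𝕜, Measurable h ∧ ∀ ξ, ∀ᵐ x ∂μ, T ξ x = h x * ξ x := by
  let χ (A : {A : Set Ω // MeasurableSet A ∧ μ A < ∞}) : Lp 𝕜 p μ :=
    indicatorConstLp p A.2.1 A.2.2.ne 1
  have hχ (A) : ∀ᵐ x ∂μ, x ∈ A.1 → χ A x = 1 := indicatorConstLp_coeFn_mem
  obtain ⟨h, h_meas, hh⟩ := hμ.exists_measurable_glue (fun A => A.2.1)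
    (fun A => (Lp.stronglyMeasurable (T (χ A))).measurable) fun A B => by
      filter_upwards [hχ A, hχ B, hT.ae_mul_eq_mul (χ A) (χ B)] with x hA hB h_mul hxA hxB
      simpa only [hA hxA, hB hxB, mul_one, one_mul] using h_mul
  refine ⟨h, h_meas, fun ξ => hμ.ae_of_forall_measure_lt_top (measurableSet_eq_fun
    (Lp.stronglyMeasurable (T ξ)).measurable
    (h_meas.mul (Lp.stronglyMeasurable ξ).measurable)) fun A hA hA_lt => ?_⟩
  filter_upwards [hχ ⟨A, hA, hA_lt⟩, hh ⟨A, hA, hA_lt⟩, hT.ae_mul_eq_mul ξ (χ ⟨A, hA, hA_lt⟩)]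
    with x h_one h_eq h_mul hxA
  rwa [h_one hxA, mul_one, ← h_eq hxA, mul_comm] at h_mul

lemma IsLocalOnLp.exists_multiplier (hμ : IsLocalizable μ) {T : Lp 𝕜 p μ →L[𝕜] Lp 𝕜 p μ}
    (hT : IsLocalOnLp T) :
    ∃ h : Lp 𝕜 ∞ μ, ‖h‖ ≤ ‖T‖ ∧ ∀ ξ, ∀ᵐ x ∂μ, T ξ x = h x * ξ x := by
  obtain ⟨h, h_meas, hh⟩ := hT.exists_measurable_multiplier hμ
  have h_bound : ∀ᵐ x ∂μ, ‖h x‖ ≤ ‖T‖ := by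
    refine hμ.ae_of_forall_measure_lt_top (h_meas.norm measurableSet_Iic) fun A hA hA_lt => ?_
    let χ : Lp 𝕜 p μ := indicatorConstLp p hA hA_lt.ne 1
    have hχ : ∀ᵐ x ∂μ, x ∈ A → χ x = 1 := indicatorConstLp_coeFn_mem
    filter_upwards [hχ, hh χ, hT.ae_norm_apply_le (norm_nonneg T) T.le_opNorm χ]
      with x h_one h_eq h_le hxA
    simpa only [h_eq, h_one hxA, mul_one, norm_one] using h_le
  have h_mem : MemLp h ∞ μ := memLp_top_of_bound h_meas.aestronglyMeasurable ‖T‖ h_bound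
  refine ⟨h_mem.toLp, ?_, fun ξ => ?_⟩
  · rw [Lp.norm_toLp, eLpNorm_exponent_top]
    exact ENNReal.toReal_le_of_le_ofReal (norm_nonneg T) (eLpNormEssSup_le_of_ae_bound h_bound)
  · filter_upwards [hh ξ, h_mem.coeFn_toLp] with x h_eq h_coe
    rw [h_eq, h_coe]

lemma IsContractive.exists_multiplier_Lp {X : Type*} [TopologicalSpace X] (hμ : IsLocalizable μ)
    {π : C₀(X, 𝕜) →ₙₐ[𝕜] (Lp 𝕜 p μ →L[𝕜] Lp 𝕜 p μ)} (hπ : IsContractive π)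
    (h_local : ∀ a, IsLocalOnLp (π a)) :
    ∃ π₀ : C₀(X, 𝕜) →ₗ[𝕜] Lp 𝕜 ∞ μ,
      (∀ a b, ∀ᵐ x ∂μ, π₀ (a * b) x = π₀ a x * π₀ b x) ∧ IsContractive π₀ ∧
      ∀ a ξ, ∀ᵐ x ∂μ, π a ξ x = π₀ a x * ξ x := by
  choose h h_norm h_mul using fun a => (h_local a).exists_multiplier hμ
  have h_unique {b : C₀(X, 𝕜)} {k : Lp 𝕜 ∞ μ} (hk : ∀ ξ, ∀ᵐ x ∂μ, π b ξ x = k x * ξ x) :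
      h b = k :=
    hμ.eq_of_forall_ae_mul_eq_mul (p := p) fun ξ => by
      filter_upwards [h_mul b ξ, hk ξ] with x hb hk
      rw [← hb, hk]
  refine ⟨⟨⟨h, fun a b => h_unique fun ξ => ?_⟩, fun c a => h_unique fun ξ => ?_⟩, fun a b => ?_,
    fun a => (h_norm a).trans (hπ a), h_mul⟩
  · rw [map_add, add_apply]
    filter_upwards [h_mul a ξ, h_mul b ξ, Lp.coeFn_add (π a ξ) (π b ξ), Lp.coeFn_add (h a) (h b)]
      with x ha hb h_add hh_add
    rw [h_add, hh_add, Pi.add_apply, Pi.add_apply, ha, hb, add_mul]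
  · have h_map : π (c • a) ξ = c • π a ξ := by rw [map_smul, smul_apply]
    rw [h_map]
    filter_upwards [h_mul a ξ, Lp.coeFn_smul c (π a ξ), Lp.coeFn_smul c (h a)]
      with x ha h_smul hh_smul
    rw [RingHom.id_apply, h_smul, hh_smul, Pi.smul_apply, Pi.smul_apply, ha, smul_mul_assoc]
  · have h_mem : MemLp (fun x => h a x * h b x) ∞ μ := (Lp.memLp (h b)).mul (Lp.memLp (h a))
    have h_prod : h (a * b) = h_mem.toLp := h_unique fun ξ => by
      rw [map_mul, mul_apply_eq_comp]
      filter_upwards [h_mul a (π b ξ), h_mul b ξ, h_mem.coeFn_toLp] with x ha hb h_coe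
      rw [ha, hb, h_coe, mul_assoc]
    change h (a * b) =ᵐ[μ] fun x => h a x * h b x
    rw [h_prod]
    exact h_mem.coeFn_toLp

end MultipliersOnLp

section PositiveRepresentationsOnC0

variable {X Y 𝕜 : Type*} [TopologicalSpace X] [TopologicalSpace Y] [RCLike 𝕜]

lemma exists_zeroAtInfty_nonneg_decomposition (f : C₀(X, 𝕜)) :
    ∃ (c : Fin 4 → 𝕜) (g : Fin 4 → C₀(X, 𝕜)), f = ∑ i, c i • g i ∧ (∀ i x, 0 ≤ g i x) ∧
      ∀ i x, ‖g i x‖ ≤ ‖f x‖ := by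
  obtain ⟨c, φ, hφ_nonneg, hφ_norm, h_sum⟩ := exists_nonneg_decomposition 𝕜
  have hφ_zero (i : Fin 4) : φ i 0 = 0 := by simpa using hφ_norm i 0
  refine ⟨c, fun i => zeroAtInftyPostcomp (φ i) (hφ_zero i) f, ?_,
    fun i x => hφ_nonneg i (f x), fun i x => hφ_norm i (f x)⟩
  ext x
  simpa only [Fin.sum_univ_four, ZeroAtInftyContinuousMap.add_apply,
    ZeroAtInftyContinuousMap.smul_apply, zeroAtInftyPostcomp_apply, smul_eq_mul] using h_sum (f x)

lemma isClosed_zeroAtInfty_nonneg : IsClosed {f : C₀(X, 𝕜) | ∀ x, 0 ≤ f x} := by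
  have h_eval (x : X) : Continuous fun f : C₀(X, 𝕜) => f x :=
    (BoundedContinuousFunction.lipschitz_eval_const x).continuous.comp
      ZeroAtInftyContinuousMap.isometry_toBCF.continuous
  rw [Set.ofPred_forall]
  exact isClosed_iInter fun x => isClosed_le continuous_const (h_eval x)

lemma IsNondegenerate.isLocalOnC0_of_isPositiveOnC0
    {π : C₀(X, 𝕜) →ₙₐ[𝕜] (C₀(Y, 𝕜) →L[𝕜] C₀(Y, 𝕜))} (hnd : IsNondegenerate π)
    (hπ : IsContractive π) (h_pos : ∀ a : C₀(X, 𝕜), (∀ x, 0 ≤ a x) → IsPositiveOnC0 (π a))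
    (a : C₀(X, 𝕜)) : IsLocalOnC0 (π a) := by
  have h_nonneg {b : C₀(X, 𝕜)} {η : C₀(Y, 𝕜)} {y : Y} (hb : ∀ x, 0 ≤ b x) (hη : ∀ z, 0 ≤ η z)
      (hy : η y = 0) : π b η y = 0 := by
    have h_upper := hnd.norm_smul_sub_apply_mem hπ isClosed_zeroAtInfty_nonneg h_pos hb hη y
    rw [ZeroAtInftyContinuousMap.sub_apply, ZeroAtInftyContinuousMap.smul_apply, hy, smul_zero,
      sub_nonneg] at h_upper
    exact h_upper.antisymm (h_pos b hb η hη y)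
  intro ξ y hξ
  obtain ⟨c, b, rfl, hb, -⟩ := exists_zeroAtInfty_nonneg_decomposition a
  obtain ⟨d, η, hξ_eq, hη, hη_norm⟩ := exists_zeroAtInfty_nonneg_decomposition ξ
  have h_zero (i j) : π (b i) (η j) y = 0 :=
    h_nonneg (hb i) (hη j) (norm_le_zero_iff.1 ((hη_norm j y).trans_eq (by rw [hξ, norm_zero])))
  rw [hξ_eq]
  simp [Fin.sum_univ_four, h_zero]

end PositiveRepresentationsOnC0

section PositiveRepresentationsOnLp

variable {X 𝕜 Ω : Type*} [TopologicalSpace X] [RCLike 𝕜] [MeasurableSpace Ω] {μ : Measure Ω}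
  {p : ℝ≥0∞}

lemma exists_Lp_nonneg_decomposition (ξ : Lp 𝕜 p μ) :
    ∃ (c : Fin 4 → 𝕜) (η : Fin 4 → Lp 𝕜 p μ), ξ = ∑ i, c i • η i ∧ (∀ i, 0 ≤ η i) ∧
      ∀ i, ∀ᵐ x ∂μ, ‖η i x‖ ≤ ‖ξ x‖ := by
  obtain ⟨c, φ, hφ_nonneg, hφ_norm, h_sum⟩ := exists_nonneg_decomposition 𝕜
  have h_mem (i : Fin 4) : MemLp (fun x => φ i (ξ x)) p μ :=
    (Lp.memLp ξ).of_le ((φ i).continuous.comp_aestronglyMeasurable (Lp.aestronglyMeasurable ξ))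
      (ae_of_all μ fun x => hφ_norm i (ξ x))
  refine ⟨c, fun i => (h_mem i).toLp, Lp.ext ?_, fun i => (Lp.coeFn_nonneg _).1 ?_, fun i => ?_⟩
  · filter_upwards [Lp.coeFn_fun_finsetSum Finset.univ fun i => c i • (h_mem i).toLp,
      ae_all_iff.2 fun i => Lp.coeFn_smul (c i) (h_mem i).toLp,
      ae_all_iff.2 fun i => (h_mem i).coeFn_toLp] with x h_coe h_smul h_toLp
    rw [h_coe, h_sum (ξ x)]
    simp only [h_smul, h_toLp, Pi.smul_apply, smul_eq_mul]
  · filter_upwards [(h_mem i).coeFn_toLp] with x hx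
    rw [hx]
    exact hφ_nonneg i (ξ x)
  · filter_upwards [(h_mem i).coeFn_toLp] with x hx
    rw [hx]
    exact hφ_norm i (ξ x)

lemma Lp_ae_sum_smul_eq_zero {ι : Type*} [Fintype ι] (c : ι → 𝕜) (η : ι → Lp 𝕜 p μ) :
    ∀ᵐ x ∂μ, (∀ i, η i x = 0) → (∑ i, c i • η i) x = 0 := by
  filter_upwards [Lp.coeFn_fun_finsetSum Finset.univ fun i => c i • η i,
    ae_all_iff.2 fun i => Lp.coeFn_smul (c i) (η i)] with x h_coe h_smul h_zero
  rw [h_coe]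
  refine Finset.sum_eq_zero fun i _ => ?_
  rw [h_smul, Pi.smul_apply, h_zero, smul_zero]

variable [Fact (1 ≤ p)] {π : C₀(X, 𝕜) →ₙₐ[𝕜] (Lp 𝕜 p μ →L[𝕜] Lp 𝕜 p μ)}

lemma IsNondegenerate.ae_apply_eq_zero_of_nonneg (hnd : IsNondegenerate π)
    (hπ : IsContractive π) (h_pos : ∀ a : C₀(X, 𝕜), (∀ x, 0 ≤ a x) → IsPositiveOnLp (π a))
    {b : C₀(X, 𝕜)} (hb : ∀ x, 0 ≤ b x) {η : Lp 𝕜 p μ} (hη : 0 ≤ η) :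
    ∀ᵐ x ∂μ, η x = 0 → π b η x = 0 := by
  have h_mono (b : C₀(X, 𝕜)) (hb : ∀ x, 0 ≤ b x) (η : Lp 𝕜 p μ) (hη : 0 ≤ η) : 0 ≤ π b η :=
    (Lp.coeFn_nonneg _).1 (h_pos b hb η ((Lp.coeFn_nonneg η).2 hη))
  have h_upper : π b η ≤ (‖b‖ : 𝕜) • η :=
    sub_nonneg.1 (hnd.norm_smul_sub_apply_mem hπ isClosed_Ici h_mono hb hη)
  filter_upwards [(Lp.coeFn_nonneg _).2 (h_mono b hb η hη), (Lp.coeFn_le _ _).2 h_upper,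
    Lp.coeFn_smul (‖b‖ : 𝕜) η] with x h_ge h_le h_smul hx
  rw [h_smul, Pi.smul_apply, hx, smul_zero] at h_le
  exact h_le.antisymm h_ge

lemma IsNondegenerate.isLocalOnLp_of_isPositiveOnLp (hnd : IsNondegenerate π)
    (hπ : IsContractive π) (h_pos : ∀ a : C₀(X, 𝕜), (∀ x, 0 ≤ a x) → IsPositiveOnLp (π a))
    (a : C₀(X, 𝕜)) : IsLocalOnLp (π a) := by
  intro ξ
  obtain ⟨c, b, rfl, hb, -⟩ := exists_zeroAtInfty_nonneg_decomposition a
  obtain ⟨d, η, hξ_eq, hη, hη_norm⟩ := exists_Lp_nonneg_decomposition ξ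
  have h_sum : π (∑ i, c i • b i) ξ =
      ∑ k : Fin 4 × Fin 4, (d k.1 * c k.2) • π (b k.2) (η k.1) := by
    rw [hξ_eq]
    simp only [map_sum, map_smul, sum_apply, smul_apply, Fintype.sum_prod_type,
      Finset.smul_sum, smul_smul]
  rw [h_sum]
  filter_upwards [Lp_ae_sum_smul_eq_zero (fun k : Fin 4 × Fin 4 => d k.1 * c k.2)
      fun k => π (b k.2) (η k.1),
    ae_all_iff.2 fun k : Fin 4 × Fin 4 =>
      hnd.ae_apply_eq_zero_of_nonneg hπ h_pos (hb k.2) (hη k.1),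
    ae_all_iff.2 hη_norm] with x h_sum_zero h_zero h_norm hξ
  have hη_zero (j) : η j x = 0 := norm_le_zero_iff.1 ((h_norm j).trans_eq (by rw [hξ, norm_zero]))
  exact h_sum_zero fun k => h_zero k (hη_zero k.1)

end PositiveRepresentationsOnLp

theorem mainTheorem6_general {X : Type*} [TopologicalSpace X]
    {Ω : Type*} [MeasurableSpace Ω] (μ : Measure Ω) (p : ℝ≥0∞) [Fact (1 ≤ p)]
    {Y : Type*} [TopologicalSpace Y] (𝕜 : Type*) [RCLike 𝕜] :
    (p ≠ 2 → ∀ π : C₀(X, ℂ) →ₙₐ[ℂ] (Lp ℂ p μ →L[ℂ] Lp ℂ p μ),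
      IsContractive π → IsNondegenerate π →
        ∀ a : C₀(X, ℂ), (∀ x, 0 ≤ a x) → IsPositiveOnLp (π a)) ∧
    (IsLocalizable μ → ∀ π : C₀(X, 𝕜) →ₙₐ[𝕜] (Lp 𝕜 p μ →L[𝕜] Lp 𝕜 p μ),
      IsContractive π → IsNondegenerate π →
        (∀ a : C₀(X, 𝕜), (∀ x, 0 ≤ a x) → IsPositiveOnLp (π a)) →
        ∃ π₀ : C₀(X, 𝕜) →ₗ[𝕜] Lp 𝕜 ∞ μ,
          (∀ a b : C₀(X, 𝕜), ∀ᵐ x ∂μ, π₀ (a * b) x = π₀ a x * π₀ b x) ∧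
          IsContractive π₀ ∧
          ∀ (a : C₀(X, 𝕜)) (ξ : Lp 𝕜 p μ), ∀ᵐ x ∂μ, (π a ξ) x = π₀ a x * ξ x) ∧
    (∀ π : C₀(X, ℂ) →ₙₐ[ℂ] (C₀(Y, ℂ) →L[ℂ] C₀(Y, ℂ)),
      IsContractive π → IsNondegenerate π →
        ∀ a : C₀(X, ℂ), (∀ x, 0 ≤ a x) → IsPositiveOnC0 (π a)) ∧
    ((∀ y, ∃ f : C₀(Y, 𝕜), f y ≠ 0) → ∀ π : C₀(X, 𝕜) →ₙₐ[𝕜] (C₀(Y, 𝕜) →L[𝕜] C₀(Y, 𝕜)),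
      IsContractive π → IsNondegenerate π →
        (∀ a : C₀(X, 𝕜), (∀ x, 0 ≤ a x) → IsPositiveOnC0 (π a)) →
        ∃ π₀ : C₀(X, 𝕜) →ₙₐ[𝕜] (Y →ᵇ 𝕜), IsContractive π₀ ∧
          ∀ (a : C₀(X, 𝕜)) (ξ : C₀(Y, 𝕜)) (x : Y), (π a ξ) x = π₀ a x * ξ x) :=
  ⟨fun hp _ hπ hnd _ ha => hnd.isPositiveOnLp_of_ne_two hp hπ ha,
    fun hμ _ hπ hnd h_pos =>
      hπ.exists_multiplier_Lp hμ (hnd.isLocalOnLp_of_isPositiveOnLp hπ h_pos),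
    fun _ hπ hnd _ ha => hnd.isPositiveOnC0 hπ ha,
    fun hY _ hπ hnd h_pos =>
      hπ.exists_multiplier_C0 hY (hnd.isLocalOnC0_of_isPositiveOnC0 hπ h_pos)⟩

theorem mainTheorem6 {X : Type*} [TopologicalSpace X] [LocallyCompactSpace X] [T2Space X]
    {Ω : Type*} [MeasurableSpace Ω] (μ : Measure Ω) (hμ : IsLocalizable μ)
    (p : ℝ≥0∞) [Fact (1 ≤ p)] (hp : p ≠ 2)
    {Y : Type*} [TopologicalSpace Y] [LocallyCompactSpace Y] [T2Space Y]
    (𝕜 : Type*) [RCLike 𝕜] :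
    -- complex scalars, `E = L^p(μ)`: positivity is automatic
    (∀ π : C₀(X, ℂ) →ₙₐ[ℂ] (Lp ℂ p μ →L[ℂ] Lp ℂ p μ),
      IsContractive π → IsNondegenerate π →
        ∀ a : C₀(X, ℂ), (∀ x, 0 ≤ a x) → IsPositiveOnLp (π a)) ∧
    -- real or complex scalars, `E = L^p(μ)`: positive implies multiplication operators
    (∀ π : C₀(X, 𝕜) →ₙₐ[𝕜] (Lp 𝕜 p μ →L[𝕜] Lp 𝕜 p μ),
      IsContractive π → IsNondegenerate π →
        (∀ a : C₀(X, 𝕜), (∀ x, 0 ≤ a x) → IsPositiveOnLp (π a)) →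
        -- `π₀` is a contractive algebra homomorphism into `L^∞(μ)`
        ∃ π₀ : C₀(X, 𝕜) →ₗ[𝕜] Lp 𝕜 ∞ μ,
          (∀ a b : C₀(X, 𝕜), ∀ᵐ x ∂μ, π₀ (a * b) x = π₀ a x * π₀ b x) ∧
          IsContractive π₀ ∧
          ∀ (a : C₀(X, 𝕜)) (ξ : Lp 𝕜 p μ), ∀ᵐ x ∂μ, (π a ξ) x = π₀ a x * ξ x) ∧
    -- complex scalars, `E = C_0(Y)`: positivity is automatic
    (∀ π : C₀(X, ℂ) →ₙₐ[ℂ] (C₀(Y, ℂ) →L[ℂ] C₀(Y, ℂ)),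
      IsContractive π → IsNondegenerate π →
        ∀ a : C₀(X, ℂ), (∀ x, 0 ≤ a x) → IsPositiveOnC0 (π a)) ∧
    -- real or complex scalars, `E = C_0(Y)`: positive implies multiplication operators
    (∀ π : C₀(X, 𝕜) →ₙₐ[𝕜] (C₀(Y, 𝕜) →L[𝕜] C₀(Y, 𝕜)),
      IsContractive π → IsNondegenerate π →
        (∀ a : C₀(X, 𝕜), (∀ x, 0 ≤ a x) → IsPositiveOnC0 (π a)) →
        ∃ π₀ : C₀(X, 𝕜) →ₙₐ[𝕜] (Y →ᵇ 𝕜), IsContractive π₀ ∧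
          ∀ (a : C₀(X, 𝕜)) (ξ : C₀(Y, 𝕜)) (x : Y), (π a ξ) x = π₀ a x * ξ x) := by
  obtain ⟨h_pos_Lp, h_mul_Lp, h_pos_C0, h_mul_C0⟩ := mainTheorem6_general (X := X) (Y := Y) μ p 𝕜
  exact ⟨h_pos_Lp hp, h_mul_Lp hμ, h_pos_C0, h_mul_C0 fun y => exists_zeroAtInfty_apply_ne_zero 𝕜 y⟩
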